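/- Notation. For an $n$-point metric space $(\mathcal M,d_{\mathcal M})$ and $c>0$ say that $\mathcal M$ has property $\mathcal D(c)$ if the following holds for every finite-dimensional real normed space $(X,\|\cdot\|_X)$ and every $\alpha\in[1,\infty)$. If there is $f:\mathcal M\to X$ with $\|f(x)-f(y)\|_X\le\alpha\, d_{\mathcal M}(x,y)$ for all $x,y\in\mathcal M$ and $\frac1{n^2}\sum_{x,y\in\mathcal M}\|f(x)-f(y)\|_X\ge\frac1{n^2}\sum_{x,y\in\mathcal M}d_{\mathcal M}(x,y)$, and if moreover $\dim(X)\ge 2$ or $\alpha\le c\log n$, then $\dim(X)\ge n^{c/\alpha}$. (Infinite-dimensional $X$ satisfy the conclusion trivially.) For a finite connected graph $\mathsf G$ with vertex set $\{1,\dots,n\}$, $n\ge 2$, and edge set $\mathsf E_{\mathsf G}$, let $d_{\mathsf G}$ be its shortest-path metric and let $\lambda_2(\mathsf G)$ be the second largest eigenvalue, counted with multiplicity, of its random walk matrix $\mathsf A_{\mathsf G}$, where $(\mathsf A_{\mathsf G})_{ij}=1/\deg_{\mathsf G}(i)$ if $\{i,j\}\in\mathsf E_{\mathsf G}$ and $(\mathsf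 A_{\mathsf G})_{ij}=0$ otherwise. **Theorem.** 1. There is a universal constant $c\in(0,\infty)$ such that for arbitrarily large $n\in\mathbb N$ there is an $n$-point metric space with property $\mathcal D(c)$. 2. Any bounded-degree spectral expander is such a space. Namely, for every integer $r\ge 0$ and every $\varepsilon>0$ there is $c=c(r,\varepsilon)>0$ such that for every $n\ge 2$ and every connected $n$-vertex graph $\mathsf G$ all of whose degrees are at most $r$ and which satisfies $\lambda_2(\mathsf G)\le 1-\varepsilon$, the metric space $(\{1,\dots,n\},d_{\mathsf G})$ has property $\mathcal D(c)$. Such expanders exist: there are an integer $r\ge3$ and $\varepsilon>0$ for which there are connected $r$-regular graphs $\mathsf G$ with arbitrarily many vertices and $\lambda_2(\mathsf G)\le1-\varepsilon$. 3. There are universal constants $c,\kappa\in(0,\infty)$ with the following property. Let $n,r\ge3$ be integers, let $\mathsf G$ be a connected $r$-regular graph on $\{1,\dots,n\}$, let $\alpha>0$, let $(X,\|\cdot\|_X)$ be a finite-dimensional real normed space, and suppose that $f:\{1,\dots,n\}\to X$ satisfies $$\bigg(\frac1{|\mathsf E_{\mathsf G}|}\sum_{\{i,j\}\in\mathsf E_{\mathsf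 G}}\|f(i)-f(j)\|_X^2\bigg)^{\frac12}\le\alpha\qquad\text{and}\qquad\bigg(\frac1{n^2}\sum_{i=1}^n\sum_{j=1}^n\|f(i)-f(j)\|_X^2\bigg)^{\frac12}\ge\frac1{n^2}\sum_{i=1}^n\sum_{j=1}^nd_{\mathsf G}(i,j).$$ Then $$\dim(X)\ge\kappa\, n^{\frac{c(1-\lambda_2(\mathsf G))}{\alpha\log r}}.$$ -/

import Mathlib

universe u

/-- The average `(1/n²) ∑_{x,y} φ(x,y)` of a function over all pairs of points of an `n`-point set. -/
noncomputable def pairAverage {M : Type} [Fintype M] (φ : M → M → ℝ) : ℝ :=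
  1 / (Fintype.card M : ℝ) ^ 2 * ∑ x, ∑ y, φ x y

/-- The `n`-point space `M` with metric `d` is intrinsically high dimensional on average, with
constant `c`: if `f : M → X` is `α`-Lipschitz, `α ≥ 1`, and does not decrease the average distance,
then `dim X ≥ n ^ (c / α)`, unless `dim X = 1` and `α > c log n` simultaneously (every space maps
to the real line in this way when `α` is large, so this case has to be left out).
Infinite dimensional `X` satisfy any lower bound on the dimension. -/
def ForcesAverageDimension {M : Type} [Fintype M] (d : M → M → ℝ) (c : ℝ) : Prop :=
  ∀ (X : Type u) [NormedAddCommGroup X] [NormedSpace ℝ X] [FiniteDimensional ℝ X]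
    (α : ℝ) (f : M → X), 1 ≤ α →
    (∀ x y, ‖f x - f y‖ ≤ α * d x y) →
    pairAverage d ≤ pairAverage (fun x y => ‖f x - f y‖) →
    (2 ≤ Module.finrank ℝ X ∨ α ≤ c * Real.log (Fintype.card M)) →
    (Fintype.card M : ℝ) ^ (c / α) ≤ (Module.finrank ℝ X : ℝ)

/-- The transition matrix of the simple random walk on a graph. -/
noncomputable def randomWalkMatrix {V : Type} [Fintype V] (G : SimpleGraph V)
    [DecidableRel G.Adj] : Matrix V V ℝ :=
  Matrix.of fun i j => if G.Adj i j then 1 / (G.degree i : ℝ) else 0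

/-- The second entry of the decreasing list of the real eigenvalues of a square matrix, repeated
according to multiplicity (the value is `0` if there are fewer than two). A random walk
matrix of a graph is self-adjoint for the degree weights, so all its eigenvalues are real. -/
noncomputable def secondEigenvalue {V : Type} [Fintype V] [DecidableEq V]
    (A : Matrix V V ℝ) : ℝ :=
  (A.charpoly.roots.sort (· ≥ ·)).getD 1 0

/-- `λ₂(G)`: the second largest eigenvalue of the random walk matrix. -/
noncomputable def graphLambda2 {V : Type} [Fintype V] [DecidableEq V] (G : SimpleGraph V)
    [DecidableRel G.Adj] : ℝ :=
  secondEigenvalue (randomWalkMatrix G)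

/-- The shortest-path metric of a (connected) graph. -/
noncomputable def graphDist {V : Type} (G : SimpleGraph V) (x y : V) : ℝ := (G.dist x y : ℝ)

/-- The average `(1/|E|) ∑_{{i,j} ∈ E} ‖f i - f j‖²` over the (unordered) edges of a graph. -/
noncomputable def edgeAverageSq {V : Type} [Fintype V] [DecidableEq V] (G : SimpleGraph V)
    [DecidableRel G.Adj] {X : Type u} [NormedAddCommGroup X] (f : V → X) : ℝ :=
  1 / (G.edgeFinset.card : ℝ) * ∑ e ∈ G.edgeFinset,
    Sym2.lift ⟨fun i j => ‖f i - f j‖ ^ 2, fun i j => by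
      simp only [norm_sub_rev]⟩ e

/-! The heart is a Poincaré inequality for maps into a `k`-dimensional normed space that loses only
a factor of order `log (2k)` in `L²` (`energySq_le_of_sum_smul_eq_zero`). Run the lazy random walk
for `t` steps on a mean-zero `f`. In any normed space averaging is an `L²` contraction, so
telescoping bounds the distance from `f` to its average after `t` steps by `t` times the gradient of
`f`. In coordinates of an Auerbach basis the scalar spectral gap makes the averaged function decay
exponentially in `t`, at the price of a factor `k²` in energy. Taking `t` of order `log (2k) / ε`
beats this price, and `f` is controlled by `t` times its gradient.

In a graph of degree at most `r`, balls grow at most geometrically, so the average distance is at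
least `log n / (6 log r)`. A map that does not shrink it and whose gradient is of order `α` must
therefore satisfy `log n ≲ α log (2k)`, a lower bound on `k` by a power of `n`.

Expanders come from two shears and two translations of `(ℤ/m)²`. After a Fourier transform,
translations become multiplications by characters, so a nearly invariant function has its transform
concentrated near the origin, where the dual shears act as on `ℤ²`. Ping-pong on quadrants then
forces the transform to be small away from the origin (`sum_norm_sq_le_of_shears`). A five-layer
lift turns this action into a simple 4-regular graph. -/

/-! ### Variational bounds for the second eigenvalue of a symmetric matrix. -/

section SecondEigenvalue

open Matrix

variable {V : Type} [Fintype V] [DecidableEq V]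

/-- Diagonalization of a real symmetric matrix by an orthonormal basis, in which the place `i₁` of
the second largest eigenvalue and the place `i₀` of the largest one are marked. -/
lemma Matrix.IsHermitian.exists_diagonalization_secondEigenvalue {S : Matrix V V ℝ}
    (hS : S.IsHermitian) (hV : 2 ≤ Fintype.card V) :
    ∃ (b : V → V → ℝ) (ev : V → ℝ) (i₀ i₁ : V), i₀ ≠ i₁ ∧ ev i₁ = secondEigenvalue S ∧
      secondEigenvalue S ≤ ev i₀ ∧ (∀ i, i ≠ i₀ → ev i ≤ secondEigenvalue S) ∧
      (∀ i j, b i ⬝ᵥ b j = if i = j then 1 else 0) ∧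
      (∀ h : V → ℝ, h ⬝ᵥ h = ∑ i, (b i ⬝ᵥ h) ^ 2) ∧
      ∀ h : V → ℝ, h ⬝ᵥ S *ᵥ h = ∑ i, ev i * (b i ⬝ᵥ h) ^ 2 := by
  set B := hS.eigenvectorBasis with hB
  set σ := Fintype.equivOfCardEq (α := Fin (Fintype.card V)) (β := V) (Fintype.card_fin _)
  have hinner : ∀ x y : EuclideanSpace ℝ V, inner ℝ x y = x.ofLp ⬝ᵥ y.ofLp := by
    intro x y
    rw [EuclideanSpace.inner_eq_star_dotProduct, dotProduct_comm]; simp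
  have hsec : secondEigenvalue S = hS.eigenvalues₀ ⟨1, hV⟩ := by
    have := hS.sort_roots_charpoly_eq_eigenvalues₀
    have h2 : S.charpoly.roots.map (RCLike.re : ℝ → ℝ) = S.charpoly.roots := by
      conv_rhs => rw [← Multiset.map_id S.charpoly.roots]
      exact Multiset.map_congr rfl fun x _ => by simp
    rw [h2] at this
    rw [secondEigenvalue, this, List.getD_eq_getElem _ _ (by simp; omega)]
    simp
  have hev : ∀ k, hS.eigenvalues (σ k) = hS.eigenvalues₀ k := by
    intro k; simp [IsHermitian.eigenvalues, σ]
  refine ⟨fun i => (B i).ofLp, hS.eigenvalues, σ ⟨0, by omega⟩, σ ⟨1, hV⟩, ?_, ?_, ?_, ?_, ?_, ?_, ?_⟩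
  · simp
  · rw [hev, hsec]
  · rw [hev, hsec]; exact hS.eigenvalues₀_antitone (by simp [Fin.le_def])
  · intro i hi
    obtain ⟨k, rfl⟩ := σ.surjective i
    rw [hev, hsec]
    refine hS.eigenvalues₀_antitone ?_
    rw [Fin.le_def]
    rcases Nat.eq_zero_or_pos k.1 with h | h
    · exact absurd (congrArg σ (Fin.ext h)) hi
    · exact h
  · intro i j
    rw [← hinner]
    exact orthonormal_iff_ite.1 B.orthonormal i j
  · intro h
    have := B.sum_inner_mul_inner (WithLp.toLp 2 h) (WithLp.toLp 2 h)
    simp only [hinner] at this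
    rw [← this]
    exact Finset.sum_congr rfl fun i _ => by rw [dotProduct_comm h, sq]
  · intro h
    have := B.sum_inner_mul_inner (WithLp.toLp 2 h) (WithLp.toLp 2 (S *ᵥ h))
    simp only [hinner] at this
    rw [← this]
    refine Finset.sum_congr rfl fun i _ => ?_
    have hs : Sᵀ = S := by simpa using hS.eq
    have h1 := hS.mulVec_eigenvectorBasis i
    rw [dotProduct_mulVec, ← mulVec_transpose, hs, h1, smul_dotProduct, dotProduct_comm h]
    simp only [smul_eq_mul]
    ring

/-- The top vector `b i₀` of the chosen basis need not be parallel to `v`. When the second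
eigenvalue is below `1`, `v` is not orthogonal to `b i₀`, so subtracting a multiple of `v` makes `g`
orthogonal to `b i₀`. This adds `a² (v ⬝ᵥ v)` to both quadratic forms, which only weakens the
desired bound's right side. -/
lemma Matrix.IsHermitian.dotProduct_mulVec_le_secondEigenvalue {S : Matrix V V ℝ}
    (hS : S.IsHermitian) (hV : 2 ≤ Fintype.card V) {v : V → ℝ} (hv : S *ᵥ v = v) (hv0 : v ≠ 0)
    (hle : ∀ h : V → ℝ, h ⬝ᵥ S *ᵥ h ≤ h ⬝ᵥ h) {g : V → ℝ} (hg : g ⬝ᵥ v = 0) :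
    g ⬝ᵥ S *ᵥ g ≤ secondEigenvalue S * (g ⬝ᵥ g) := by
  obtain ⟨b, ev, i₀, i₁, -, -, -, hle2, -, hsq, hq⟩ :=
    hS.exists_diagonalization_secondEigenvalue hV
  have key : ∀ w : V → ℝ, b i₀ ⬝ᵥ w = 0 → w ⬝ᵥ S *ᵥ w ≤ secondEigenvalue S * (w ⬝ᵥ w) := by
    intro w hw
    rw [hq, hsq, Finset.mul_sum]
    refine Finset.sum_le_sum fun i _ => ?_
    rcases eq_or_ne i i₀ with rfl | h
    · simp [hw]
    · exact mul_le_mul_of_nonneg_right (hle2 i h) (sq_nonneg _)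
  have hvv : 0 < v ⬝ᵥ v := by
    exact lt_of_le_of_ne (Finset.sum_nonneg fun i _ => mul_self_nonneg _)
      (Ne.symm (mt dotProduct_self_eq_zero.1 hv0))
  have hgg : 0 ≤ g ⬝ᵥ g := Finset.sum_nonneg fun i _ => mul_self_nonneg _
  rcases le_or_gt 1 (secondEigenvalue S) with h1 | h1
  · nlinarith [hle g]
  have hbv : b i₀ ⬝ᵥ v ≠ 0 := by
    intro h
    have := key v h
    rw [hv] at this
    nlinarith
  set a := (b i₀ ⬝ᵥ g) / (b i₀ ⬝ᵥ v) with ha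
  have hw := key (g - a • v) (by
    rw [dotProduct_sub, dotProduct_smul, ha, smul_eq_mul, div_mul_cancel₀ _ hbv, sub_self])
  have hs : Sᵀ = S := by simpa using hS.eq
  have hvg : v ⬝ᵥ g = 0 := by rw [dotProduct_comm, hg]
  have hvSg : v ⬝ᵥ S *ᵥ g = 0 := by
    rw [dotProduct_mulVec, ← mulVec_transpose, hs, hv, hvg]
  simp only [mulVec_sub, mulVec_smul, hv, dotProduct_sub, sub_dotProduct, dotProduct_smul,
    smul_dotProduct, hg, hvg, hvSg, smul_eq_mul] at hw
  nlinarith [mul_nonneg (sq_nonneg a) hvv.le]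

/-- Courant–Fischer: the plane spanned by the top two eigenvectors meets the hyperplane orthogonal
to `v`, and on that plane the quotient is at least the second eigenvalue. -/
lemma Matrix.IsHermitian.secondEigenvalue_le {S : Matrix V V ℝ}
    (hS : S.IsHermitian) (hV : 2 ≤ Fintype.card V) (v : V → ℝ) {μ : ℝ}
    (h : ∀ g : V → ℝ, g ⬝ᵥ v = 0 → g ⬝ᵥ S *ᵥ g ≤ μ * (g ⬝ᵥ g)) : secondEigenvalue S ≤ μ := by
  obtain ⟨b, ev, i₀, i₁, hne, hev1, hev0, -, hb, hsq, hq⟩ :=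
    hS.exists_diagonalization_secondEigenvalue hV
  have key : ∀ s t : ℝ, (s • b i₀ + t • b i₁) ⬝ᵥ v = 0 →
      ev i₀ * s ^ 2 + ev i₁ * t ^ 2 ≤ μ * (s ^ 2 + t ^ 2) := by
    intro s t hst
    have := h _ hst
    have hc : ∀ c : V → ℝ, ∑ i, c i * (b i ⬝ᵥ (s • b i₀ + t • b i₁)) ^ 2 =
        c i₀ * s ^ 2 + c i₁ * t ^ 2 := by
      intro c
      rw [← Finset.add_sum_erase _ _ (Finset.mem_univ i₀),
        ← Finset.add_sum_erase _ _ (Finset.mem_erase.2 ⟨hne.symm, Finset.mem_univ i₁⟩),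
        Finset.sum_eq_zero]
      · simp [dotProduct_add, hb, hne, hne.symm]
      · intro i hi
        simp only [Finset.mem_erase, Finset.mem_univ, and_true] at hi
        simp [dotProduct_add, hb, hi.1, hi.2]
    have h1 := hc fun _ => 1
    simp only [one_mul] at h1
    rwa [hq, hsq, hc, h1] at this
  rcases eq_or_ne (b i₁ ⬝ᵥ v) 0 with h0 | h0
  · have := key 0 1 (by simp [h0])
    simp only [ne_eq, OfNat.ofNat_ne_zero, not_false_eq_true, zero_pow, mul_zero, one_pow,
      mul_one, zero_add] at this
    rwa [hev1] at this
  -- The coefficients are chosen to cancel the pairing with `v`; the first one is nonzero in this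
  -- case.
  · have := key (b i₁ ⬝ᵥ v) (-(b i₀ ⬝ᵥ v)) (by
      simp only [add_dotProduct, smul_dotProduct, smul_eq_mul]; ring)
    rw [hev1] at this
    have hp : 0 < (b i₁ ⬝ᵥ v) ^ 2 := by positivity
    by_contra! hlt
    nlinarith [mul_nonneg (sub_nonneg.2 hev0) hp.le, sq_nonneg (b i₀ ⬝ᵥ v),
      mul_pos (sub_pos.2 hlt) hp, mul_nonneg (sub_nonneg.2 hlt.le) (sq_nonneg (b i₀ ⬝ᵥ v))]

lemma Matrix.IsHermitian.neg_one_le_secondEigenvalue {S : Matrix V V ℝ}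
    (hS : S.IsHermitian) (hV : 2 ≤ Fintype.card V)
    (hle : ∀ h : V → ℝ, -(h ⬝ᵥ h) ≤ h ⬝ᵥ S *ᵥ h) : -1 ≤ secondEigenvalue S := by
  obtain ⟨b, ev, i₀, i₁, -, hev1, -, -, hb, hsq, hq⟩ :=
    hS.exists_diagonalization_secondEigenvalue hV
  have := hle (b i₁)
  rw [hq, hb] at this
  simpa [hb, hev1] using this

end SecondEigenvalue

/-! ### Reversible Markov chains and their symmetrization. -/

section ReversibleWeights

open Matrix

variable {V : Type} [Fintype V] [DecidableEq V]

/-- The symmetric matrix similar to the random walk matrix of a weighted graph. -/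
noncomputable def normalizedWeights (w : V → V → ℝ) : Matrix V V ℝ :=
  Matrix.of fun i j => (√(∑ k, w i k))⁻¹ * w i j * (√(∑ k, w j k))⁻¹

omit [DecidableEq V] in
lemma normalizedWeights_isHermitian {w : V → V → ℝ} (hsymm : ∀ i j, w i j = w j i) :
    (normalizedWeights w).IsHermitian := by
  ext i j
  simp [normalizedWeights, hsymm i j]; ring

omit [DecidableEq V] in
lemma dotProduct_normalizedWeights (w : V → V → ℝ) (hpos : ∀ i, 0 < ∑ k, w i k) (g : V → ℝ) :
    (fun i => √(∑ k, w i k) * g i) ⬝ᵥ normalizedWeights w *ᵥ (fun i => √(∑ k, w i k) * g i) =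
      ∑ i, ∑ j, w i j * (g i * g j) := by
  simp only [dotProduct, mulVec, normalizedWeights, of_apply, Finset.mul_sum]
  refine Finset.sum_congr rfl fun i _ => Finset.sum_congr rfl fun j _ => ?_
  have hi := (Real.sqrt_pos.2 (hpos i)).ne'
  have hj := (Real.sqrt_pos.2 (hpos j)).ne'
  field_simp

omit [DecidableEq V] in
lemma sum_sum_mul_sq_right {w : V → V → ℝ} (hsymm : ∀ i j, w i j = w j i) (φ : V → ℝ) :
    ∑ i, ∑ j, w i j * φ j = ∑ i, (∑ j, w i j) * φ i := by
  rw [Finset.sum_comm]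
  refine Finset.sum_congr rfl fun i _ => ?_
  rw [Finset.sum_mul]
  exact Finset.sum_congr rfl fun j _ => by rw [hsymm]

omit [DecidableEq V] in
lemma abs_sum_sum_mul_mul_le {w : V → V → ℝ} (hsymm : ∀ i j, w i j = w j i)
    (hw : ∀ i j, 0 ≤ w i j) (g : V → ℝ) :
    |∑ i, ∑ j, w i j * (g i * g j)| ≤ ∑ i, (∑ j, w i j) * g i ^ 2 := by
  have h1 := sum_sum_mul_sq_right hsymm fun i => g i ^ 2
  have h2 : ∑ i, (∑ j, w i j) * g i ^ 2 = ∑ i, ∑ j, w i j * ((g i ^ 2 + g j ^ 2) / 2) := by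
    have : ∑ i, ∑ j, w i j * ((g i ^ 2 + g j ^ 2) / 2) =
        (∑ i, (∑ j, w i j) * g i ^ 2 + ∑ i, ∑ j, w i j * g j ^ 2) / 2 := by
      rw [← Finset.sum_add_distrib, Finset.sum_div]
      refine Finset.sum_congr rfl fun i _ => ?_
      rw [Finset.sum_mul, ← Finset.sum_add_distrib, Finset.sum_div]
      exact Finset.sum_congr rfl fun j _ => by ring
    rw [this, h1]; ring
  rw [h2]
  refine (Finset.abs_sum_le_sum_abs _ _).trans (Finset.sum_le_sum fun i _ => ?_)
  refine (Finset.abs_sum_le_sum_abs _ _).trans (Finset.sum_le_sum fun j _ => ?_)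
  rw [abs_mul, abs_of_nonneg (hw i j)]
  refine mul_le_mul_of_nonneg_left ?_ (hw i j)
  rw [abs_le]
  constructor <;> nlinarith [sq_nonneg (g i + g j), sq_nonneg (g i - g j)]

/-- The two matrices are `M * N` and `N * M` with `M = D^(-1/2)` and `N = D^(-1/2) W`, so they share
a characteristic polynomial. -/
lemma secondEigenvalue_eq_normalizedWeights {w : V → V → ℝ} (hpos : ∀ i, 0 < ∑ k, w i k) :
    secondEigenvalue (Matrix.of fun i j => w i j / ∑ k, w i k) =
      secondEigenvalue (normalizedWeights w) := by
  have h1 : (Matrix.of fun i j => w i j / ∑ k, w i k) =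
      diagonal (fun i => (√(∑ k, w i k))⁻¹) * (diagonal (fun i => (√(∑ k, w i k))⁻¹) * of w) := by
    ext i j
    simp only [diagonal_mul, of_apply]
    rw [← mul_assoc, ← mul_inv, Real.mul_self_sqrt (hpos i).le]
    rw [div_eq_inv_mul]
  have h2 : normalizedWeights w =
      (diagonal (fun i => (√(∑ k, w i k))⁻¹) * of w) * diagonal (fun i => (√(∑ k, w i k))⁻¹) := by
    ext i j
    simp [mul_diagonal, diagonal_mul, normalizedWeights]
  rw [secondEigenvalue, secondEigenvalue, h1, h2, charpoly_mul_comm]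

omit [DecidableEq V] in
lemma exists_eq_sqrt_mul {w : V → V → ℝ} (hpos : ∀ i, 0 < ∑ k, w i k) (h : V → ℝ) :
    ∃ g : V → ℝ, h = fun i => √(∑ k, w i k) * g i := by
  refine ⟨fun i => h i / √(∑ k, w i k), funext fun i => ?_⟩
  have := (Real.sqrt_pos.2 (hpos i)).ne'
  field_simp

omit [DecidableEq V] in
lemma dotProduct_sqrt_mul {w : V → V → ℝ} (hpos : ∀ i, 0 < ∑ k, w i k) (g h : V → ℝ) :
    (fun i => √(∑ k, w i k) * g i) ⬝ᵥ (fun i => √(∑ k, w i k) * h i) =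
      ∑ i, (∑ k, w i k) * (g i * h i) := by
  refine Finset.sum_congr rfl fun i _ => ?_
  have := Real.mul_self_sqrt (hpos i).le
  linear_combination (g i * h i) * this

variable {w : V → V → ℝ} (hsymm : ∀ i j, w i j = w j i) (hw : ∀ i j, 0 ≤ w i j)
  (hpos : ∀ i, 0 < ∑ k, w i k) (hV : 2 ≤ Fintype.card V)

include hsymm hw hpos hV

/-- The second eigenvalue of a reversible Markov chain bounds its quadratic form on functions of
mean zero. -/
lemma sum_sum_mul_le_secondEigenvalue {g : V → ℝ} (hg : ∑ i, (∑ k, w i k) * g i = 0) :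
    ∑ i, ∑ j, w i j * (g i * g j) ≤
      secondEigenvalue (Matrix.of fun i j => w i j / ∑ k, w i k) *
        ∑ i, (∑ k, w i k) * g i ^ 2 := by
  rw [secondEigenvalue_eq_normalizedWeights hpos, ← dotProduct_normalizedWeights w hpos]
  have h2 := dotProduct_sqrt_mul hpos g g
  simp only [← sq] at h2
  rw [← h2]
  -- Constants correspond to the eigenvector `√d` of eigenvalue `1`; the factor `1` keeps it in the
  -- form used by `dotProduct_sqrt_mul`.
  refine (normalizedWeights_isHermitian hsymm).dotProduct_mulVec_le_secondEigenvalue hV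
    (v := fun i => √(∑ k, w i k) * 1) ?_ ?_ ?_ ?_
  · funext i
    simp only [mulVec, dotProduct, normalizedWeights, of_apply]
    have : ∀ j, (√(∑ k, w i k))⁻¹ * w i j * (√(∑ k, w j k))⁻¹ * (√(∑ k, w j k) * 1) =
        (√(∑ k, w i k))⁻¹ * w i j := by
      intro j
      have hj := (Real.sqrt_pos.2 (hpos j)).ne'
      field_simp
    have hi := (Real.sqrt_pos.2 (hpos i)).ne'
    rw [Finset.sum_congr rfl fun j _ => this j, ← Finset.mul_sum, mul_one, inv_mul_eq_div,
      div_eq_iff hi, Real.mul_self_sqrt (hpos i).le]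
  · have : Nonempty V := Fintype.card_pos_iff.1 (by omega)
    intro h
    have := congrFun h (Classical.arbitrary V)
    simp [(Real.sqrt_pos.2 (hpos _)).ne'] at this
  · intro h
    obtain ⟨h, rfl⟩ := exists_eq_sqrt_mul hpos h
    rw [dotProduct_normalizedWeights w hpos, dotProduct_sqrt_mul hpos]
    simp only [← sq]
    exact (le_abs_self _).trans (abs_sum_sum_mul_mul_le hsymm hw h)
  · rw [dotProduct_sqrt_mul hpos]; simpa using hg

/-- This makes the lazy contraction factor `(1 + λ₂) / 2` nonnegative and any gap at most `2`. -/
lemma neg_one_le_secondEigenvalue :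
    -1 ≤ secondEigenvalue (Matrix.of fun i j => w i j / ∑ k, w i k) := by
  rw [secondEigenvalue_eq_normalizedWeights hpos]
  refine (normalizedWeights_isHermitian hsymm).neg_one_le_secondEigenvalue hV fun h => ?_
  obtain ⟨h, rfl⟩ := exists_eq_sqrt_mul hpos h
  rw [dotProduct_normalizedWeights w hpos, dotProduct_sqrt_mul hpos]
  simp only [← sq]
  exact neg_le_of_abs_le (abs_sum_sum_mul_mul_le hsymm hw h)

omit hw in
lemma secondEigenvalue_le_of_sum_sum_mul_le {μ : ℝ}
    (h : ∀ g : V → ℝ, ∑ i, (∑ k, w i k) * g i = 0 →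
      ∑ i, ∑ j, w i j * (g i * g j) ≤ μ * ∑ i, (∑ k, w i k) * g i ^ 2) :
    secondEigenvalue (Matrix.of fun i j => w i j / ∑ k, w i k) ≤ μ := by
  rw [secondEigenvalue_eq_normalizedWeights hpos]
  refine (normalizedWeights_isHermitian hsymm).secondEigenvalue_le hV
    (fun i => √(∑ k, w i k) * 1) fun g hg => ?_
  obtain ⟨g, rfl⟩ := exists_eq_sqrt_mul hpos g
  rw [dotProduct_sqrt_mul hpos] at hg
  rw [dotProduct_normalizedWeights w hpos, dotProduct_sqrt_mul hpos]
  simp only [← sq]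
  exact h g (by simpa using hg)

end ReversibleWeights

/-! ### Auerbach bases. -/

section Auerbach

/-- **Auerbach's lemma**: a finite dimensional normed space has a basis of vectors of norm at most
one whose coordinate functionals have norm at most one. -/
lemma exists_auerbach_basis (X : Type*) [NormedAddCommGroup X] [NormedSpace ℝ X]
    [FiniteDimensional ℝ X] :
    ∃ b : Module.Basis (Fin (Module.finrank ℝ X)) ℝ X,
      (∀ i, ‖b i‖ ≤ 1) ∧ ∀ x i, |b.repr x i| ≤ ‖x‖ := by
  classical
  set k := Module.finrank ℝ X
  let b₀ : Module.Basis (Fin k) ℝ X := Module.finBasis ℝ X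
  have : ProperSpace X := FiniteDimensional.proper ℝ X
  let K : Set (Fin k → X) := Set.univ.pi fun _ => Metric.closedBall 0 1
  have hK : IsCompact K := isCompact_univ_pi fun _ => isCompact_closedBall 0 1
  have hcont : Continuous fun v : Fin k → X => |b₀.det v| := by
    simp only [Module.Basis.det_apply]
    refine (Continuous.matrix_det ?_).abs
    refine continuous_matrix fun i j => ?_
    have : Continuous (b₀.coord i) := LinearMap.continuous_of_finiteDimensional _
    exact this.comp (continuous_apply j)
  -- The basis maximizes the absolute determinant over families in the unit ball.
  obtain ⟨v, hvK, hmax⟩ := hK.exists_isMaxOn ⟨0, fun _ _ => by simp⟩ hcont.continuousOn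
  have hmax' : ∀ u ∈ K, |b₀.det u| ≤ |b₀.det v| := fun u hu => hmax hu
  have hv1 : ∀ i, ‖v i‖ ≤ 1 := fun i => by simpa using hvK i trivial
  have hpos : b₀.det v ≠ 0 := by
    -- a small multiple of `b₀` has nonzero determinant
    have hN : ∀ i, 0 < ‖b₀ i‖ := fun i => norm_pos_iff.2 (b₀.ne_zero i)
    have h1 := hmax' (fun i => ‖b₀ i‖⁻¹ • b₀ i) (fun i _ => by
      simp [norm_smul, inv_mul_cancel₀ (hN i).ne'])
    rw [AlternatingMap.map_smul_univ] at h1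
    intro h0
    rw [h0, abs_zero, Module.Basis.det_self, smul_eq_mul, mul_one] at h1
    exact absurd h1 (not_le.2 (abs_pos.2 (Finset.prod_ne_zero_iff.2
      fun i _ => inv_ne_zero (hN i).ne')))
  have hbasis := (Module.Basis.is_basis_iff_det b₀ (v := v)).2 (Ne.isUnit hpos)
  let b : Module.Basis (Fin k) ℝ X := Module.Basis.mk hbasis.1 hbasis.2.ge
  have hb : ∀ i, b i = v i := fun i => by simp [b]
  refine ⟨b, fun i => by rw [hb]; exact hv1 i, fun x i => ?_⟩
  rcases eq_or_ne x 0 with rfl | hx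
  · simp
  have hxn : 0 < ‖x‖ := norm_pos_iff.2 hx
  -- Replacing `v i` by `x / ‖x‖` cannot increase the determinant; by Cramer's rule the ratio of the
  -- determinants is the `i`-th coordinate.
  have h1 := hmax' (Function.update v i (‖x‖⁻¹ • x)) (fun j _ => by
    rcases eq_or_ne j i with rfl | h
    · simp [norm_smul, inv_mul_cancel₀ hxn.ne']
    · simpa [h] using hv1 j)
  have h2 : b₀.det (Function.update v i x) = b.repr x i * b₀.det v := by
    conv_lhs => rw [← b.sum_repr x]
    rw [AlternatingMap.map_update_sum]
    rw [Finset.sum_eq_single i]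
    · rw [AlternatingMap.map_update_smul, hb, Function.update_eq_self, smul_eq_mul]
    · intro j _ hj
      rw [AlternatingMap.map_update_smul, hb]
      rw [AlternatingMap.map_eq_zero_of_eq _ _ (i := i) (j := j) _ hj.symm, smul_zero]
      simp [hj]
    · simp
  rw [AlternatingMap.map_update_smul, h2, smul_eq_mul, abs_mul, abs_mul, abs_inv, abs_norm,
    ← mul_assoc] at h1
  have h3 := le_of_mul_le_mul_right (h1.trans_eq (one_mul _).symm) (abs_pos.2 hpos)
  rwa [inv_mul_le_iff₀ hxn, mul_one] at h3

end Auerbach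

/-! ### The vector-valued Poincaré inequality via the lazy walk. -/

section Poincare

variable {V : Type} [Fintype V] {w : V → V → ℝ}
variable {X : Type*} [NormedAddCommGroup X] [NormedSpace ℝ X]

/-- One step of the lazy random walk with transition probabilities proportional to `w`. -/
noncomputable def lazyStep (w : V → V → ℝ) (f : V → X) (i : V) : X :=
  (1 / 2 : ℝ) • (f i + (∑ k, w i k)⁻¹ • ∑ j, w i j • f j)

/-- The square of the norm of `f` in `L²` of the stationary measure. -/
noncomputable def energySq (w : V → V → ℝ) (f : V → X) : ℝ :=
  ∑ i, (∑ k, w i k) * ‖f i‖ ^ 2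

lemma lazyStep_sub (f g : V → X) : lazyStep w (f - g) = lazyStep w f - lazyStep w g := by
  funext i
  simp only [lazyStep, Pi.sub_apply, smul_sub, smul_add, Finset.sum_sub_distrib]
  abel

lemma lazyStep_iterate_sub (t : ℕ) (f g : V → X) :
    (lazyStep w)^[t] (f - g) = (lazyStep w)^[t] f - (lazyStep w)^[t] g := by
  induction t with
  | zero => rfl
  | succ t ih => simp only [Function.iterate_succ_apply', ih, lazyStep_sub]

lemma lazyStep_comp (L : X →ₗ[ℝ] ℝ) (f : V → X) :
    (fun i => L (lazyStep w f i)) = lazyStep w fun i => L (f i) := by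
  funext i
  simp [lazyStep, mul_add]

lemma lazyStep_iterate_comp (t : ℕ) (L : X →ₗ[ℝ] ℝ) (f : V → X) :
    (fun i => L ((lazyStep w)^[t] f i)) = (lazyStep w)^[t] fun i => L (f i) := by
  induction t with
  | zero => rfl
  | succ t ih => rw [Function.iterate_succ_apply', Function.iterate_succ_apply', ← ih,
      ← lazyStep_comp]

lemma norm_sum_smul_sq_le {ι : Type*} (s : Finset ι) (a : ι → ℝ) (ha : ∀ i ∈ s, 0 ≤ a i)
    (x : ι → X) : ‖∑ i ∈ s, a i • x i‖ ^ 2 ≤ (∑ i ∈ s, a i) * ∑ i ∈ s, a i * ‖x i‖ ^ 2 := by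
  have h1 : ‖∑ i ∈ s, a i • x i‖ ≤ ∑ i ∈ s, a i * ‖x i‖ := by
    refine (norm_sum_le _ _).trans_eq (Finset.sum_congr rfl fun i hi => ?_)
    rw [norm_smul, Real.norm_of_nonneg (ha i hi)]
  refine (pow_le_pow_left₀ (norm_nonneg _) h1 2).trans ?_
  refine Finset.sum_sq_le_sum_mul_sum_of_sq_le_mul s ha
    (fun i hi => mul_nonneg (ha i hi) (sq_nonneg _)) fun i _ => le_of_eq (by ring)

variable (hsymm : ∀ i j, w i j = w j i) (hw : ∀ i j, 0 ≤ w i j)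
  (hpos : ∀ i, 0 < ∑ k, w i k)

omit [NormedSpace ℝ X] in
include hw in
lemma energySq_nonneg (f : V → X) : 0 ≤ energySq w f :=
  Finset.sum_nonneg fun i _ => mul_nonneg (Finset.sum_nonneg fun k _ => hw i k) (sq_nonneg _)

include hsymm hw hpos

/-- Convexity of the squared norm, with reversibility to resum the neighbours' contributions; no
spectral input and no dimension enters. -/
lemma energySq_lazyStep_le (f : V → X) : energySq w (lazyStep w f) ≤ energySq w f := by
  have key : ∀ i, (∑ k, w i k) * ‖lazyStep w f i‖ ^ 2 ≤
      1 / 2 * ((∑ k, w i k) * ‖f i‖ ^ 2) + 1 / 2 * ∑ j, w i j * ‖f j‖ ^ 2 := by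
    intro i
    set d := ∑ k, w i k with hd
    have hdp : 0 < d := hpos i
    set y := d⁻¹ • ∑ j, w i j • f j with hy
    have h1 : d * ‖y‖ ^ 2 ≤ ∑ j, w i j * ‖f j‖ ^ 2 := by
      have := norm_sum_smul_sq_le Finset.univ (w i) (fun j _ => hw i j) f
      rw [hy, norm_smul, mul_pow, Real.norm_of_nonneg (inv_nonneg.2 hdp.le)]
      have h2 : d * (d⁻¹ ^ 2 * ‖∑ j, w i j • f j‖ ^ 2) = d⁻¹ * ‖∑ j, w i j • f j‖ ^ 2 := by
        field_simp
      rw [h2, inv_mul_le_iff₀ hdp]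
      exact this
    have h3 : ‖lazyStep w f i‖ ≤ 1 / 2 * (‖f i‖ + ‖y‖) := by
      rw [lazyStep, norm_smul, Real.norm_of_nonneg (by norm_num)]
      exact mul_le_mul_of_nonneg_left (norm_add_le _ _) (by norm_num)
    have h4 : ‖lazyStep w f i‖ ^ 2 ≤ 1 / 2 * ‖f i‖ ^ 2 + 1 / 2 * ‖y‖ ^ 2 := by
      refine (pow_le_pow_left₀ (norm_nonneg _) h3 2).trans ?_
      nlinarith [sq_nonneg (‖f i‖ - ‖y‖)]
    nlinarith [mul_le_mul_of_nonneg_left h4 hdp.le]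
  refine (Finset.sum_le_sum fun i _ => key i).trans_eq ?_
  rw [Finset.sum_add_distrib, ← Finset.mul_sum, ← Finset.mul_sum,
    sum_sum_mul_sq_right hsymm fun j => ‖f j‖ ^ 2, energySq]
  ring

lemma energySq_lazyStep_iterate_le (t : ℕ) (f : V → X) :
    energySq w ((lazyStep w)^[t] f) ≤ energySq w f := by
  induction t with
  | zero => rfl
  | succ t ih =>
    rw [Function.iterate_succ_apply']
    exact (energySq_lazyStep_le hsymm hw hpos _).trans ih

omit hsymm in
lemma energySq_sub_lazyStep_le (f : V → X) :
    energySq w (f - lazyStep w f) ≤ 1 / 4 * ∑ i, ∑ j, w i j * ‖f i - f j‖ ^ 2 := by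
  rw [energySq, Finset.mul_sum]
  refine Finset.sum_le_sum fun i _ => ?_
  set d := ∑ k, w i k with hd
  have hdp : 0 < d := hpos i
  have h1 : (f - lazyStep w f) i = (2 * d)⁻¹ • ∑ j, w i j • (f i - f j) := by
    simp only [Pi.sub_apply, lazyStep, smul_sub, Finset.sum_sub_distrib, ← Finset.sum_smul, ← hd,
      smul_add, smul_smul]
    have h2 : (2 * d)⁻¹ * d = 1 / 2 := by field_simp
    have h3 : (2 * d)⁻¹ = 1 / 2 * d⁻¹ := by rw [mul_inv]; norm_num
    rw [h2, h3]
    have h4 : f i = (1 / 2 : ℝ) • f i + (1 / 2 : ℝ) • f i := by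
      rw [← add_smul]; norm_num
    nth_rewrite 1 [h4]
    abel
  have h5 := norm_sum_smul_sq_le Finset.univ (w i) (fun j _ => hw i j) fun j => f i - f j
  rw [h1, norm_smul, mul_pow, Real.norm_of_nonneg (by positivity)]
  have h6 : d * ((2 * d)⁻¹ ^ 2 * ‖∑ j, w i j • (f i - f j)‖ ^ 2) =
      1 / 4 * (d⁻¹ * ‖∑ j, w i j • (f i - f j)‖ ^ 2) := by
    field_simp; ring
  rw [h6]
  refine mul_le_mul_of_nonneg_left ?_ (by norm_num)
  rw [inv_mul_le_iff₀ hdp]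
  exact h5

/-- Telescope the difference into the iterates of `f - lazyStep w f`, each bounded by contraction.
Cauchy–Schwarz over the `t` terms yields `t²`. -/
lemma energySq_sub_lazyStep_iterate_le (t : ℕ) (f : V → X) :
    energySq w (f - (lazyStep w)^[t] f) ≤
      (t : ℝ) ^ 2 * (1 / 4 * ∑ i, ∑ j, w i j * ‖f i - f j‖ ^ 2) := by
  have hd : ∀ i, 0 ≤ ∑ k, w i k := fun i => (hpos i).le
  have h1 : energySq w (f - (lazyStep w)^[t] f) ≤
      t * ∑ s ∈ Finset.range t, energySq w ((lazyStep w)^[s] (f - lazyStep w f)) := by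
    simp only [energySq]
    rw [Finset.sum_comm, Finset.mul_sum]
    refine Finset.sum_le_sum fun i _ => ?_
    rw [← Finset.mul_sum, mul_left_comm]
    refine mul_le_mul_of_nonneg_left ?_ (hd i)
    have h2 : (f - (lazyStep w)^[t] f) i =
        ∑ s ∈ Finset.range t, (1 : ℝ) • ((lazyStep w)^[s] (f - lazyStep w f)) i := by
      simp only [one_smul, lazyStep_iterate_sub, ← Function.iterate_succ_apply, Pi.sub_apply]
      rw [Finset.sum_range_sub' (fun s => (lazyStep w)^[s] f i)]
      rfl
    rw [h2]
    have := norm_sum_smul_sq_le (Finset.range t) (fun _ => (1 : ℝ)) (fun _ _ => zero_le_one)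
      (fun s => ((lazyStep w)^[s] (f - lazyStep w f)) i)
    simpa using this
  refine h1.trans ?_
  have h3 : ∑ s ∈ Finset.range t, energySq w ((lazyStep w)^[s] (f - lazyStep w f)) ≤
      t * (1 / 4 * ∑ i, ∑ j, w i j * ‖f i - f j‖ ^ 2) := by
    refine (Finset.sum_le_card_nsmul _ _ _ fun s _ =>
      (energySq_lazyStep_iterate_le hsymm hw hpos s _).trans
        (energySq_sub_lazyStep_le hw hpos f)).trans_eq ?_
    simp
  rw [sq, mul_assoc]
  exact mul_le_mul_of_nonneg_left h3 (Nat.cast_nonneg t)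

omit hw in
lemma sum_mul_lazyStep {g : V → ℝ} (hg : ∑ i, (∑ k, w i k) * g i = 0) :
    ∑ i, (∑ k, w i k) * lazyStep w g i = 0 := by
  have key : ∀ i, (∑ k, w i k) * lazyStep w g i =
      1 / 2 * ((∑ k, w i k) * g i + ∑ j, w i j * g j) := by
    intro i
    have := (hpos i).ne'
    simp only [lazyStep, smul_eq_mul]
    field_simp
  rw [Finset.sum_congr rfl fun i _ => key i, ← Finset.mul_sum, Finset.sum_add_distrib,
    sum_sum_mul_sq_right hsymm g, hg]
  simp

variable [DecidableEq V] (hV : 2 ≤ Fintype.card V)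
include hV

/-- Expanding the square of `(g + Pg) / 2` gives `1/4 + λ₂/2 + 1/4`. Laziness makes the upper end of
the spectrum sufficient: negative eigenvalues do no harm. -/
lemma energySq_lazyStep_le_of_sum_eq_zero {g : V → ℝ} (hg : ∑ i, (∑ k, w i k) * g i = 0) :
    energySq w (lazyStep w g) ≤
      (1 + secondEigenvalue (Matrix.of fun i j => w i j / ∑ k, w i k)) / 2 * energySq w g := by
  set l := secondEigenvalue (Matrix.of fun i j => w i j / ∑ k, w i k)
  have h1 := sum_sum_mul_le_secondEigenvalue hsymm hw hpos hV hg
  have key : ∀ i, (∑ k, w i k) * ‖lazyStep w g i‖ ^ 2 ≤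
      1 / 4 * ((∑ k, w i k) * g i ^ 2) + 1 / 2 * (∑ j, w i j * (g i * g j)) +
        1 / 4 * ∑ j, w i j * g j ^ 2 := by
    intro i
    set d := ∑ k, w i k with hd
    have hdp : 0 < d := hpos i
    have h2 := norm_sum_smul_sq_le Finset.univ (w i) (fun j _ => hw i j) g
    have h3 : ∑ j, w i j * (g i * g j) = g i * ∑ j, w i j * g j := by
      rw [Finset.mul_sum]; exact Finset.sum_congr rfl fun j _ => by ring
    simp only [smul_eq_mul, Real.norm_eq_abs, sq_abs, ← hd] at h2
    rw [h3]
    set y := ∑ j, w i j * g j with hy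
    have h4 : d * ‖lazyStep w g i‖ ^ 2 = 1 / 4 * (d * g i ^ 2) + 1 / 2 * (g i * y)
        + 1 / 4 * (d⁻¹ * y ^ 2) := by
      simp only [lazyStep, smul_eq_mul, Real.norm_eq_abs, sq_abs, ← hy, ← hd]
      field_simp
      ring
    have h5 : d⁻¹ * y ^ 2 ≤ ∑ j, w i j * g j ^ 2 := by
      rwa [inv_mul_le_iff₀ hdp]
    rw [h4]; linarith
  refine (Finset.sum_le_sum fun i _ => key i).trans ?_
  rw [Finset.sum_add_distrib, Finset.sum_add_distrib, ← Finset.mul_sum, ← Finset.mul_sum,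
    ← Finset.mul_sum, sum_sum_mul_sq_right hsymm fun j => g j ^ 2]
  simp only [energySq, Real.norm_eq_abs, sq_abs]
  linarith

lemma energySq_lazyStep_iterate_le_of_sum_eq_zero (t : ℕ) {g : V → ℝ}
    (hg : ∑ i, (∑ k, w i k) * g i = 0) :
    energySq w ((lazyStep w)^[t] g) ≤
      ((1 + secondEigenvalue (Matrix.of fun i j => w i j / ∑ k, w i k)) / 2) ^ t *
        energySq w g := by
  have hl := neg_one_le_secondEigenvalue hsymm hw hpos hV
  have : ∑ i, (∑ k, w i k) * (lazyStep w)^[t] g i = 0 ∧ energySq w ((lazyStep w)^[t] g) ≤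
      ((1 + secondEigenvalue (Matrix.of fun i j => w i j / ∑ k, w i k)) / 2) ^ t *
        energySq w g := by
    induction t with
    | zero => simpa using hg
    | succ t ih =>
      simp only [Function.iterate_succ_apply']
      refine ⟨sum_mul_lazyStep hsymm hpos ih.1,
        (energySq_lazyStep_le_of_sum_eq_zero hsymm hw hpos hV ih.1).trans ?_⟩
      rw [pow_succ', mul_assoc]
      exact mul_le_mul_of_nonneg_left ih.2 (by linarith)
  exact this.2

variable [FiniteDimensional ℝ X]

/-- Auerbach coordinates reduce to the scalar case. One factor of the dimension comes from
Cauchy–Schwarz on the coordinates, the other from summing coordinate energies, each at most that of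
`f`. -/
lemma energySq_lazyStep_iterate_le_finrank (t : ℕ) {f : V → X}
    (hf : ∑ i, (∑ k, w i k) • f i = 0) :
    energySq w ((lazyStep w)^[t] f) ≤ (Module.finrank ℝ X : ℝ) ^ 2 *
      (((1 + secondEigenvalue (Matrix.of fun i j => w i j / ∑ k, w i k)) / 2) ^ t *
        energySq w f) := by
  set μ := (1 + secondEigenvalue (Matrix.of fun i j => w i j / ∑ k, w i k)) / 2 with hμ
  have hμ0 : 0 ≤ μ := by
    have := neg_one_le_secondEigenvalue hsymm hw hpos hV
    rw [hμ]; linarith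
  obtain ⟨b, hb1, hb2⟩ := exists_auerbach_basis X
  have hd : ∀ i, 0 ≤ ∑ k, w i k := fun i => (hpos i).le
  have h1 : energySq w ((lazyStep w)^[t] f) ≤
      Module.finrank ℝ X * ∑ c, energySq w fun i => b.coord c ((lazyStep w)^[t] f i) := by
    simp only [energySq]
    rw [Finset.sum_comm, Finset.mul_sum]
    refine Finset.sum_le_sum fun i _ => ?_
    rw [← Finset.mul_sum, mul_left_comm]
    refine mul_le_mul_of_nonneg_left ?_ (hd i)
    set x := (lazyStep w)^[t] f i
    have h2 : ‖x‖ ≤ ∑ c, |b.coord c x| := by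
      conv_lhs => rw [← b.sum_repr x]
      refine (norm_sum_le _ _).trans (Finset.sum_le_sum fun c _ => ?_)
      rw [norm_smul]
      exact mul_le_of_le_one_right (norm_nonneg _) (hb1 c)
    refine (pow_le_pow_left₀ (norm_nonneg _) h2 2).trans ?_
    simpa using sq_sum_le_card_mul_sum_sq (s := Finset.univ) (f := fun c => |b.coord c x|)
  have h3 : ∀ c, energySq w (fun i => b.coord c ((lazyStep w)^[t] f i)) ≤
      μ ^ t * energySq w f := by
    intro c
    rw [lazyStep_iterate_comp]
    refine (energySq_lazyStep_iterate_le_of_sum_eq_zero hsymm hw hpos hV t ?_).trans ?_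
    · have := congrArg (b.coord c) hf
      simpa only [map_sum, map_smul, smul_eq_mul, map_zero] using this
    · refine mul_le_mul_of_nonneg_left ?_ (pow_nonneg hμ0 t)
      refine Finset.sum_le_sum fun i _ => mul_le_mul_of_nonneg_left ?_ (hd i)
      exact pow_le_pow_left₀ (norm_nonneg _) (hb2 (f i) c) 2
  refine h1.trans ?_
  rw [sq, mul_assoc]
  refine mul_le_mul_of_nonneg_left ?_ (Nat.cast_nonneg _)
  refine (Finset.sum_le_card_nsmul _ _ _ fun c _ => h3 c).trans_eq ?_
  simp

/-- **Nonlinear spectral gap**: the Poincaré inequality of a reversible Markov chain for functions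
with values in a finite dimensional normed space, with a loss logarithmic in the dimension. -/
theorem energySq_le_of_sum_smul_eq_zero {f : V → X} (hf : ∑ i, (∑ k, w i k) • f i = 0)
    {ε : ℝ} (hε : 0 < ε)
    (hgap : secondEigenvalue (Matrix.of fun i j => w i j / ∑ k, w i k) ≤ 1 - ε)
    (hk : 1 ≤ Module.finrank ℝ X) :
    energySq w f ≤ (7 * Real.log (2 * Module.finrank ℝ X) / ε) ^ 2 *
      ∑ i, ∑ j, w i j * ‖f i - f j‖ ^ 2 := by
  have hl := neg_one_le_secondEigenvalue hsymm hw hpos hV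
  set l := secondEigenvalue (Matrix.of fun i j => w i j / ∑ k, w i k) with hldef
  set k := Module.finrank ℝ X
  have hk' : (1 : ℝ) ≤ k := by exact_mod_cast hk
  have hlog : Real.log 2 ≤ Real.log (2 * k) := Real.log_le_log (by norm_num) (by linarith)
  have hlog2 := Real.log_two_gt_d9
  -- This many steps make the contraction factor at most `(2k)⁻²`, which absorbs the loss `k²` and
  -- leaves `1/4`. Using `2k` keeps the logarithm positive for `k = 1`.
  set t := ⌈4 * Real.log (2 * k) / ε⌉₊ with ht
  have ht1 : 4 * Real.log (2 * k) / ε ≤ t := Nat.le_ceil _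
  have ht2 : (t : ℝ) ≤ 7 * Real.log (2 * k) / ε := by
    have h1 : (t : ℝ) < 4 * Real.log (2 * k) / ε + 1 := Nat.ceil_lt_add_one (by
      have : 0 ≤ Real.log (2 * k) := by linarith
      positivity)
    -- Since `ε ≤ 2 < 3 log 2`, the rounding costs at most `3 log (2k) / ε`, whence `7 = 4 + 3`.
    have h2 : (1 : ℝ) ≤ 3 * Real.log (2 * k) / ε := by
      rw [le_div_iff₀ hε]; linarith
    have h3 : 7 * Real.log (2 * k) / ε = 4 * Real.log (2 * k) / ε + 3 * Real.log (2 * k) / ε := by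
      ring
    linarith
  have hμ : ((1 + l) / 2) ^ t ≤ ((2 * k : ℝ) ^ 2)⁻¹ := by
    have h1 : (1 + l) / 2 ≤ Real.exp (-(ε / 2)) := by
      have := Real.add_one_le_exp (-(ε / 2))
      linarith
    refine (pow_le_pow_left₀ (by linarith) h1 t).trans ?_
    rw [← Real.exp_nat_mul, ← Real.exp_log (show (0 : ℝ) < (2 * k) ^ 2 by positivity),
      ← Real.exp_neg]
    apply Real.exp_le_exp.2
    rw [Real.log_pow]
    have := (div_le_iff₀ hε).1 ht1
    push_cast
    linarith
  have hQ := energySq_nonneg hw f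
  have h1 : energySq w ((lazyStep w)^[t] f) ≤ 1 / 4 * energySq w f := by
    refine (energySq_lazyStep_iterate_le_finrank hsymm hw hpos hV t hf).trans ?_
    rw [← mul_assoc]
    refine mul_le_mul_of_nonneg_right ?_ hQ
    refine (mul_le_mul_of_nonneg_left hμ (by positivity)).trans_eq ?_
    have : (k : ℝ) ≠ 0 := by positivity
    change (k : ℝ) ^ 2 * ((2 * k : ℝ) ^ 2)⁻¹ = 1 / 4
    field_simp; norm_num
  have h2 : energySq w f ≤ 2 * energySq w (f - (lazyStep w)^[t] f) +
      2 * energySq w ((lazyStep w)^[t] f) := by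
    simp only [energySq, Finset.mul_sum, ← Finset.sum_add_distrib]
    refine Finset.sum_le_sum fun i _ => ?_
    have h3 : ‖f i‖ ≤ ‖(f - (lazyStep w)^[t] f) i‖ + ‖(lazyStep w)^[t] f i‖ := by
      simpa using norm_add_le ((f - (lazyStep w)^[t] f) i) ((lazyStep w)^[t] f i)
    have h4 : ‖f i‖ ^ 2 ≤
        2 * ‖(f - (lazyStep w)^[t] f) i‖ ^ 2 + 2 * ‖(lazyStep w)^[t] f i‖ ^ 2 := by
      refine (pow_le_pow_left₀ (norm_nonneg _) h3 2).trans ?_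
      nlinarith [sq_nonneg (‖(f - (lazyStep w)^[t] f) i‖ - ‖(lazyStep w)^[t] f i‖)]
    have := mul_le_mul_of_nonneg_left h4 (hpos i).le
    linarith
  have h3 := energySq_sub_lazyStep_iterate_le hsymm hw hpos t f
  have hE : 0 ≤ ∑ i, ∑ j, w i j * ‖f i - f j‖ ^ 2 :=
    Finset.sum_nonneg fun i _ => Finset.sum_nonneg fun j _ => mul_nonneg (hw i j) (sq_nonneg _)
  -- The averaged part contributes at most half of the energy of `f`, which moves to the left side.
  have h4 : energySq w f ≤ (t : ℝ) ^ 2 * ∑ i, ∑ j, w i j * ‖f i - f j‖ ^ 2 := by linarith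
  exact h4.trans (mul_le_mul_of_nonneg_right (pow_le_pow_left₀ (Nat.cast_nonneg t) ht2 2) hE)

end Poincare

/-! ### Graphs as systems of weights. -/

section GraphWeights

variable {V : Type} [Fintype V] [DecidableEq V] (G : SimpleGraph V) [DecidableRel G.Adj]

/-- The adjacency indicator of a graph, as a system of weights. -/
def adjWeight (i j : V) : ℝ := if G.Adj i j then 1 else 0

omit [Fintype V] [DecidableEq V] in
lemma adjWeight_comm (i j : V) : adjWeight G i j = adjWeight G j i := by
  simp [adjWeight, G.adj_comm]

omit [Fintype V] [DecidableEq V] in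
lemma adjWeight_nonneg (i j : V) : 0 ≤ adjWeight G i j := by
  unfold adjWeight; split_ifs <;> norm_num

omit [DecidableEq V] in
lemma sum_adjWeight (i : V) : ∑ k, adjWeight G i k = G.degree i := by
  simp only [adjWeight, Finset.sum_boole]
  rw [← G.card_neighborFinset_eq_degree, G.neighborFinset_eq_filter]

lemma graphLambda2_eq_secondEigenvalue :
    graphLambda2 G =
      secondEigenvalue (Matrix.of fun i j => adjWeight G i j / ∑ k, adjWeight G i k) := by
  rw [graphLambda2]
  congr 1
  ext i j
  simp only [randomWalkMatrix, Matrix.of_apply, sum_adjWeight]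
  simp only [adjWeight]
  split_ifs <;> simp

lemma sum_edgeFinset_eq (φ : V → V → ℝ) (hφ : ∀ i j, φ i j = φ j i) :
    2 * ∑ e ∈ G.edgeFinset, Sym2.lift ⟨φ, hφ⟩ e = ∑ i, ∑ j, adjWeight G i j * φ i j := by
  have h1 : ∑ i, ∑ j, adjWeight G i j * φ i j =
      ∑ p ∈ (Finset.univ : Finset (V × V)).filter (fun p => G.Adj p.1 p.2), φ p.1 p.2 := by
    rw [Finset.sum_filter, ← Finset.univ_product_univ, Finset.sum_product]
    simp [adjWeight]
  rw [h1, Finset.mul_sum, ← Finset.sum_fiberwise_of_maps_to (t := G.edgeFinset)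
    (g := fun p : V × V => s(p.1, p.2))]
  · refine Finset.sum_congr rfl fun e he => ?_
    induction e using Sym2.ind with
    | _ a b =>
      have hab : G.Adj a b := by simpa using he
      have : ((Finset.univ : Finset (V × V)).filter (fun p => G.Adj p.1 p.2)).filter
          (fun p => s(p.1, p.2) = s(a, b)) = {(a, b), (b, a)} := by
        ext ⟨x, y⟩
        simp only [Finset.mem_filter, Finset.mem_univ, true_and, Sym2.eq_iff, Finset.mem_insert,
          Finset.mem_singleton, Prod.mk.injEq]
        constructor
        · exact fun h => h.2
        · rintro (⟨rfl, rfl⟩ | ⟨rfl, rfl⟩)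
          · exact ⟨hab, by simp⟩
          · exact ⟨hab.symm, by simp⟩
      rw [this, Finset.sum_pair (by simp [hab.ne]), Sym2.lift_mk, hφ b a]
      ring
  · intro p hp
    simpa using hp

end GraphWeights

/-! ### Average distance in a bounded-degree graph. -/

section AverageDistance

variable {V : Type} [Fintype V] (G : SimpleGraph V) [DecidableRel G.Adj]

/-- A ball of radius `m + 1` lies in its centre together with the neighbours of the ball of radius
`m`. The extra `1` closes the induction: `1 + r B + 1 ≤ r (B + 1)` as `r ≥ 2`. -/
lemma card_filter_dist_lt {r : ℕ} (hr : 2 ≤ r) (hG : G.Connected) (hdeg : ∀ v, G.degree v ≤ r)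
    (x : V) (m : ℕ) : (Finset.univ.filter fun y => G.dist x y < m).card + 1 ≤ r ^ m := by
  classical
  induction m with
  | zero => simp
  | succ m ih =>
    have hsub : (Finset.univ.filter fun y => G.dist x y < m + 1) ⊆
        insert x ((Finset.univ.filter fun y => G.dist x y < m).biUnion
          fun y => G.neighborFinset y) := by
      intro y hy
      rw [Finset.mem_filter] at hy
      rcases eq_or_ne y x with rfl | hne
      · simp
      refine Finset.mem_insert_of_mem ?_
      obtain ⟨p, hp⟩ := hG.exists_walk_length_eq_dist y x
      cases p with
      | nil => exact absurd rfl hne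
      | cons h q =>
        rename_i z
        rw [Finset.mem_biUnion]
        refine ⟨z, ?_, by simpa using h.symm⟩
        rw [SimpleGraph.Walk.length_cons, G.dist_comm] at hp
        have := SimpleGraph.dist_le q
        rw [G.dist_comm] at this
        simp only [Finset.mem_filter, Finset.mem_univ, true_and]
        omega
    have h1 := Finset.card_le_card hsub
    have h2 := Finset.card_insert_le x ((Finset.univ.filter fun y => G.dist x y < m).biUnion
          fun y => G.neighborFinset y)
    have h3 := Finset.card_biUnion_le_card_mul (Finset.univ.filter fun y => G.dist x y < m)
      (fun y => G.neighborFinset y) r (fun y _ => by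
        rw [G.card_neighborFinset_eq_degree]; exact hdeg y)
    have h4 := Nat.mul_le_mul_right r ih
    rw [pow_succ]
    linarith

lemma log_card_le_pairAverage_graphDist {r : ℕ} (hr : 2 ≤ r) (hG : G.Connected)
    (hdeg : ∀ v, G.degree v ≤ r) (hV : 2 ≤ Fintype.card V) :
    Real.log (Fintype.card V) / (6 * Real.log r) ≤ pairAverage (graphDist G) := by
  classical
  set n := Fintype.card V with hn
  have hn0 : (0 : ℝ) < n := by exact_mod_cast (by omega : 0 < n)
  -- At this radius the ball about any point omits at least half of the graph.
  set m := Nat.log r (n / 2) with hm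
  have hm1 : r ^ m ≤ n / 2 := Nat.pow_log_le_self r (by omega)
  have hm2 : n / 2 < r ^ (m + 1) := Nat.lt_pow_succ_log_self (by omega) _
  have far : ∀ s : ℕ, r ^ s ≤ n / 2 + 1 → (s : ℝ) / 2 ≤ pairAverage (graphDist G) := by
    intro s hs
    have hrow : ∀ x, (s : ℝ) / 2 * n ≤ ∑ y, graphDist G x y := by
      intro x
      have h1 := card_filter_dist_lt G hr hG hdeg x s
      have h2 : (Finset.univ.filter fun y => G.dist x y < s).card +
          (Finset.univ.filter fun y => ¬ G.dist x y < s).card = n := by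
        rw [Finset.card_filter_add_card_filter_not]; rfl
      have h3 : n ≤ 2 * (Finset.univ.filter fun y => ¬ G.dist x y < s).card := by omega
      have h4 : (s : ℝ) * (Finset.univ.filter fun y => ¬ G.dist x y < s).card ≤
          ∑ y, graphDist G x y := by
        rw [mul_comm, ← nsmul_eq_mul]
        refine (Finset.card_nsmul_le_sum _ (fun y => graphDist G x y) _ fun y hy => ?_).trans
          (Finset.sum_le_sum_of_subset_of_nonneg (Finset.subset_univ _) fun y _ _ => by
            simp [graphDist])
        simp only [Finset.mem_filter, not_lt] at hy
        exact Nat.cast_le.2 hy.2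
      have h5 : (n : ℝ) ≤ 2 * (Finset.univ.filter fun y => ¬ G.dist x y < s).card := by
        exact_mod_cast h3
      nlinarith [mul_le_mul_of_nonneg_left h5 (Nat.cast_nonneg (α := ℝ) s)]
    have := Finset.sum_le_sum fun x (_ : x ∈ Finset.univ) => hrow x
    rw [Finset.sum_const, nsmul_eq_mul, Finset.card_univ, ← hn] at this
    rw [pairAverage, ← hn, one_div_mul_eq_div, le_div_iff₀ (by positivity)]
    linarith
  have hm3 : (m : ℝ) / 2 ≤ pairAverage (graphDist G) := far m (by omega)
  -- Distinct points are at distance at least `1`; this covers small `n`, where `m` may be `0`.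
  have h12 : (1 : ℝ) / 2 ≤ pairAverage (graphDist G) := by
    have hrow : ∀ x, (1 : ℝ) / 2 * n ≤ ∑ y, graphDist G x y := by
      intro x
      have h4 : ((n - 1 : ℕ) : ℝ) * 1 ≤ ∑ y, graphDist G x y := by
        have hc : (Finset.univ.erase x).card = n - 1 := by
          rw [Finset.card_erase_of_mem (Finset.mem_univ x), Finset.card_univ]
        rw [← hc, ← nsmul_eq_mul]
        refine (Finset.card_nsmul_le_sum _ (fun y => graphDist G x y) _ fun y hy => ?_).trans
          (Finset.sum_le_sum_of_subset_of_nonneg (Finset.subset_univ _) fun y _ _ => by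
            simp [graphDist])
        have := hG.pos_dist_of_ne (Finset.ne_of_mem_erase hy).symm
        simp only [graphDist]
        exact_mod_cast this
      have : (2 : ℝ) ≤ n := by exact_mod_cast hV
      rw [Nat.cast_sub (by omega)] at h4
      push_cast at h4
      linarith
    have := Finset.sum_le_sum fun x (_ : x ∈ Finset.univ) => hrow x
    rw [Finset.sum_const, nsmul_eq_mul, Finset.card_univ, ← hn] at this
    rw [pairAverage, ← hn, one_div_mul_eq_div, le_div_iff₀ (by positivity)]
    linarith
  have hr' : (1 : ℝ) < r := by exact_mod_cast (by omega : 1 < r)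
  have hlr : 0 < Real.log r := Real.log_pos hr'
  have hlog : Real.log n ≤ (m + 2) * Real.log r := by
    have : n ≤ r ^ (m + 2) := by
      have h1 : n < 2 * r ^ (m + 1) := by omega
      have h2 : 2 * r ^ (m + 1) ≤ r * r ^ (m + 1) := Nat.mul_le_mul_right _ hr
      rw [pow_succ' r (m + 1)]
      omega
    have h3 : (n : ℝ) ≤ (r : ℝ) ^ (m + 2) := by exact_mod_cast this
    have := Real.log_le_log hn0 h3
    rw [Real.log_pow] at this
    push_cast at this
    exact this
  -- One third of the bound `m/2` plus two thirds of the bound `1/2`.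
  have hfin : ((m : ℝ) + 2) / 6 ≤ pairAverage (graphDist G) := by
    linarith
  refine le_trans ?_ hfin
  rw [div_le_div_iff₀ (by positivity) (by norm_num)]
  linarith

end AverageDistance

/-! ### The Poincaré inequality over all pairs of vertices. -/

section GraphPoincare

variable {V : Type} [Fintype V] [DecidableEq V] (G : SimpleGraph V) [DecidableRel G.Adj]
variable {X : Type*} [NormedAddCommGroup X] [NormedSpace ℝ X] [FiniteDimensional ℝ X]

omit [DecidableEq V] in
lemma SimpleGraph.Connected.one_le_degree {G : SimpleGraph V} [DecidableRel G.Adj]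
    (hG : G.Connected) (hV : 2 ≤ Fintype.card V) (v : V) : 1 ≤ G.degree v := by
  have : Nontrivial V := Fintype.one_lt_card_iff_nontrivial.1 hV
  exact hG.preconnected.degree_pos_of_nontrivial v

/-- The Poincaré inequality for maps from a graph to a finite dimensional normed space. -/
lemma sum_sum_norm_sub_sq_le_of_graphLambda2_le (hV : 2 ≤ Fintype.card V)
    {δ : ℝ} (hδ0 : 0 < δ) (hδ : ∀ v, δ ≤ G.degree v) {ε : ℝ} (hε : 0 < ε)
    (hgap : graphLambda2 G ≤ 1 - ε) (hk : 1 ≤ Module.finrank ℝ X) (f : V → X) :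
    ∑ i, ∑ j, ‖f i - f j‖ ^ 2 ≤
      4 * Fintype.card V / δ * ((7 * Real.log (2 * Module.finrank ℝ X) / ε) ^ 2 *
        ∑ i, ∑ j, adjWeight G i j * ‖f i - f j‖ ^ 2) := by
  have hd : ∀ i, 0 < ∑ k, adjWeight G i k := fun i => by
    rw [sum_adjWeight]; exact hδ0.trans_le (hδ i)
  have : Nonempty V := Fintype.card_pos_iff.1 (by omega)
  have hD : 0 < ∑ i, ∑ k, adjWeight G i k :=
    Finset.sum_pos (fun i _ => hd i) Finset.univ_nonempty
  -- The mean for the stationary measure, which weights vertices by degree.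
  set m : X := (∑ i, ∑ k, adjWeight G i k)⁻¹ • ∑ i, (∑ k, adjWeight G i k) • f i with hm
  have hmean : ∑ i, (∑ k, adjWeight G i k) • (f i - m) = 0 := by
    simp only [smul_sub, Finset.sum_sub_distrib, ← Finset.sum_smul]
    rw [hm, smul_smul, mul_inv_cancel₀ hD.ne', one_smul, sub_self]
  rw [graphLambda2_eq_secondEigenvalue] at hgap
  have h1 := energySq_le_of_sum_smul_eq_zero (adjWeight_comm G) (adjWeight_nonneg G) hd hV
    hmean hε hgap hk
  simp only [sub_sub_sub_cancel_right] at h1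
  -- Passing from degree weights to counting costs `δ`. Taking `δ = r` for regular graphs avoids the
  -- factor `√r` that `δ = 1` leaves in the bounded-degree constant.
  have h2 : δ * ∑ i, ‖f i - m‖ ^ 2 ≤ energySq (adjWeight G) fun i => f i - m := by
    rw [Finset.mul_sum]
    refine Finset.sum_le_sum fun i _ => mul_le_mul_of_nonneg_right ?_ (sq_nonneg _)
    rw [sum_adjWeight]; exact hδ i
  have h3 : ∑ i, ∑ j, ‖f i - f j‖ ^ 2 ≤ 4 * Fintype.card V * ∑ i, ‖f i - m‖ ^ 2 := by
    have : ∀ i j, ‖f i - f j‖ ^ 2 ≤ 2 * ‖f i - m‖ ^ 2 + 2 * ‖f j - m‖ ^ 2 := by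
      intro i j
      have h4 : ‖f i - f j‖ ≤ ‖f i - m‖ + ‖f j - m‖ := by
        simpa using norm_sub_le (f i - m) (f j - m)
      refine (pow_le_pow_left₀ (norm_nonneg _) h4 2).trans ?_
      nlinarith [sq_nonneg (‖f i - m‖ - ‖f j - m‖)]
    refine (Finset.sum_le_sum fun i _ => Finset.sum_le_sum fun j _ => this i j).trans_eq ?_
    simp only [Finset.sum_add_distrib, Finset.sum_const, ← Finset.mul_sum, Finset.card_univ,
      nsmul_eq_mul]
    ring
  refine h3.trans ?_
  rw [div_mul_eq_mul_div, mul_div_assoc]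
  refine mul_le_mul_of_nonneg_left ?_ (by positivity)
  rw [le_div_iff₀ hδ0, mul_comm]
  exact h2.trans h1

end GraphPoincare

lemma pairAverage_le_sqrt_pairAverage_sq {V : Type} [Fintype V] (φ : V → V → ℝ) :
    pairAverage φ ≤ √(pairAverage fun i j => φ i j ^ 2) := by
  refine Real.le_sqrt_of_sq_le ?_
  simp only [pairAverage, ← Fintype.sum_prod_type']
  have h := sq_sum_le_card_mul_sum_sq (s := (Finset.univ : Finset (V × V)))
    (f := fun p => φ p.1 p.2)
  rw [Finset.card_univ, Fintype.card_prod] at h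
  push_cast at h
  rcases eq_or_ne (Fintype.card V : ℝ) 0 with h0 | h0
  · simp [h0]
  rw [mul_pow]
  refine (mul_le_mul_of_nonneg_left h (sq_nonneg _)).trans_eq ?_
  field_simp

lemma norm_sub_eq_zero_of_finrank_eq_zero {V : Type} {X : Type*} [NormedAddCommGroup X]
    [NormedSpace ℝ X] [FiniteDimensional ℝ X] (h : Module.finrank ℝ X = 0) (f : V → X) (i j : V) :
    ‖f i - f j‖ = 0 := by
  have := Module.finrank_zero_iff.1 h
  rw [Subsingleton.elim (f i) (f j), sub_self, norm_zero]

/-! ### Dimension lower bounds for expanders and regular graphs. -/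

section Embedding

variable {V : Type} [Fintype V] [DecidableEq V] (G : SimpleGraph V) [DecidableRel G.Adj]

/-- The constant is `168 = 6 · 7 · 2 · 2`: average distance, Poincaré constant, passage to pairs,
and `log (2k) ≤ 2 log k`. -/
theorem forcesAverageDimension_graphDist {r : ℕ} (hr : 3 ≤ r) {ε : ℝ} (hε : 0 < ε)
    (hG : G.Connected) (hV : 2 ≤ Fintype.card V) (hdeg : ∀ v, G.degree v ≤ r)
    (hgap : graphLambda2 G ≤ 1 - ε) :
    ForcesAverageDimension.{u} (graphDist G) (ε / (168 * √r * Real.log r)) := by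
  intro X _ _ _ α f hα hLip havg hor
  set n := Fintype.card V with hn
  set k := Module.finrank ℝ X with hkdef
  have hn1 : (1 : ℝ) < n := by exact_mod_cast (by omega : 1 < n)
  have hlogn : 0 < Real.log n := Real.log_pos hn1
  have hr1 : (1 : ℝ) < r := by exact_mod_cast (by omega : 1 < r)
  have hlogr : 0 < Real.log r := Real.log_pos hr1
  have hsr : 0 < √(r : ℝ) := Real.sqrt_pos.2 (by linarith)
  have hα0 : 0 < α := by linarith
  have hdist := log_card_le_pairAverage_graphDist G (by omega) hG hdeg hV
  have hk : 1 ≤ k := by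
    by_contra! hk0
    have hk0 : Module.finrank ℝ X = 0 := by omega
    have h0 : pairAverage (fun x y => ‖f x - f y‖) = 0 := by
      simp [pairAverage, norm_sub_eq_zero_of_finrank_eq_zero hk0 f]
    have : 0 < Real.log n / (6 * Real.log r) := by positivity
    linarith
  have hk1 : (1 : ℝ) ≤ k := by exact_mod_cast hk
  have hlog2k : 0 ≤ Real.log (2 * k) := Real.log_nonneg (by linarith)
  have hP := sum_sum_norm_sub_sq_le_of_graphLambda2_le G hV zero_lt_one
    (fun v => by exact_mod_cast hG.one_le_degree hV v) hε hgap hk f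
  set T := 7 * Real.log (2 * k) / ε with hT
  have hT0 : 0 ≤ T := by positivity
  have hE : ∑ i, ∑ j, adjWeight G i j * ‖f i - f j‖ ^ 2 ≤ n * (r * α ^ 2) := by
    have : ∀ i, ∑ j, adjWeight G i j * ‖f i - f j‖ ^ 2 ≤ r * α ^ 2 := by
      intro i
      have h1 : ∀ j, adjWeight G i j * ‖f i - f j‖ ^ 2 ≤ adjWeight G i j * α ^ 2 := by
        intro j
        by_cases hij : G.Adj i j
        · have := hLip i j
          rw [graphDist, SimpleGraph.dist_eq_one_iff_adj.2 hij] at this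
          refine mul_le_mul_of_nonneg_left (pow_le_pow_left₀ (norm_nonneg _) ?_ 2)
            (adjWeight_nonneg G i j)
          simpa using this
        · simp [adjWeight, hij]
      refine (Finset.sum_le_sum fun j _ => h1 j).trans ?_
      rw [← Finset.sum_mul, sum_adjWeight]
      exact mul_le_mul_of_nonneg_right (by exact_mod_cast hdeg i) (sq_nonneg _)
    refine (Finset.sum_le_card_nsmul _ _ _ fun i _ => this i).trans_eq ?_
    simp [n]
  have hupper : pairAverage (fun x y => ‖f x - f y‖) ≤ 2 * T * √r * α := by
    refine (pairAverage_le_sqrt_pairAverage_sq _).trans (Real.sqrt_le_iff.2 ⟨by positivity, ?_⟩)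
    have h1 : (2 * T * √r * α) ^ 2 = 4 * T ^ 2 * r * α ^ 2 := by
      rw [mul_pow, mul_pow, mul_pow, Real.sq_sqrt (by positivity)]; ring
    rw [h1, pairAverage, ← hn, one_div_mul_eq_div, div_le_iff₀ (by positivity)]
    refine hP.trans ((mul_le_mul_of_nonneg_left (mul_le_mul_of_nonneg_left hE (sq_nonneg T))
      (by positivity)).trans_eq ?_)
    rw [← hn]; ring
  have hmain : Real.log n / (6 * Real.log r) ≤ 2 * T * √r * α := by linarith
  set c := ε / (168 * √r * Real.log r) with hc
  have hc0 : 0 < c := by positivity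
  have hmain2 : 2 * c * Real.log n ≤ α * Real.log (2 * k) := by
    rw [div_le_iff₀ (by positivity)] at hmain
    rw [hc]
    rw [show 2 * (ε / (168 * √r * Real.log r)) * Real.log n =
      ε * Real.log n / (84 * √r * Real.log r) by field_simp; norm_num, div_le_iff₀ (by positivity)]
    rw [hT] at hmain
    refine (mul_le_mul_of_nonneg_left hmain hε.le).trans_eq ?_
    field_simp
    ring
  -- If `k = 1` and `α ≤ c log n`, then `2 c log n ≤ α log 2 ≤ c log n log 2`, which is absurd.
  have hk2 : 2 ≤ k := by
    rcases hor with h | h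
    · exact h
    by_contra! hlt
    have : k = 1 := by omega
    rw [this] at hmain2
    have hl2 := Real.log_two_lt_d9
    have hl2' := Real.log_two_gt_d9
    norm_num at hmain2
    nlinarith [mul_pos hc0 hlogn]
  have hk2' : (2 : ℝ) ≤ k := by exact_mod_cast hk2
  have hlogk : Real.log (2 * k) ≤ 2 * Real.log k := by
    rw [Real.log_mul (by norm_num) (by positivity)]
    have := Real.log_le_log (by norm_num) hk2'
    linarith
  rw [Real.rpow_def_of_pos (by linarith), ← Real.le_log_iff_exp_le (by linarith),
    mul_div_assoc', div_le_iff₀ hα0]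
  nlinarith

/-- The prefactor `1/2` absorbs the `2` in `log (2k)`, so dimension one needs no exception. -/
theorem half_mul_rpow_le_finrank {r : ℕ} (hr : 3 ≤ r) (hG : G.Connected)
    (hV : 2 ≤ Fintype.card V) (hdeg : G.IsRegularOfDegree r)
    {X : Type*} [NormedAddCommGroup X] [NormedSpace ℝ X] [FiniteDimensional ℝ X]
    {α : ℝ} (f : V → X) (hα : 0 < α) (hedge : √(edgeAverageSq G f) ≤ α)
    (havg : pairAverage (graphDist G) ≤ √(pairAverage fun i j => ‖f i - f j‖ ^ 2)) :
    1 / 2 * (Fintype.card V : ℝ) ^ (1 / 84 * (1 - graphLambda2 G) / (α * Real.log r)) ≤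
      (Module.finrank ℝ X : ℝ) := by
  set n := Fintype.card V with hn
  set k := Module.finrank ℝ X with hkdef
  have hn1 : (1 : ℝ) < n := by exact_mod_cast (by omega : 1 < n)
  have hlogn : 0 < Real.log n := Real.log_pos hn1
  have hr1 : (1 : ℝ) < r := by exact_mod_cast (by omega : 1 < r)
  have hlogr : 0 < Real.log r := Real.log_pos hr1
  have hdist := log_card_le_pairAverage_graphDist G (by omega) hG (fun v => (hdeg v).le) hV
  have hk : 1 ≤ k := by
    by_contra! hk0
    have hk0 : Module.finrank ℝ X = 0 := by omega
    have h0 : pairAverage (fun x y => ‖f x - f y‖ ^ 2) = 0 := by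
      simp [pairAverage, norm_sub_eq_zero_of_finrank_eq_zero hk0 f]
    rw [h0, Real.sqrt_zero] at havg
    have : 0 < Real.log n / (6 * Real.log r) := by positivity
    linarith
  have hk1 : (1 : ℝ) ≤ k := by exact_mod_cast hk
  have hlog2k : 0 ≤ Real.log (2 * k) := Real.log_nonneg (by linarith)
  set gap := 1 - graphLambda2 G with hgap
  -- With a nonpositive gap the exponent is nonpositive and the left side is at most `1/2`.
  rcases le_or_gt gap 0 with hg0 | hg0
  · have h1 : (n : ℝ) ^ (1 / 84 * gap / (α * Real.log r)) ≤ 1 :=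
      Real.rpow_le_one_of_one_le_of_nonpos hn1.le
        (div_nonpos_of_nonpos_of_nonneg (by linarith) (by positivity))
    linarith
  have hP := sum_sum_norm_sub_sq_le_of_graphLambda2_le G hV (δ := r) (by linarith)
    (fun v => by rw [hdeg v]) hg0 (by rw [hgap]; linarith) hk f
  set T := 7 * Real.log (2 * k) / gap with hT
  have hT0 : 0 ≤ T := by positivity
  have hcard : 2 * (G.edgeFinset.card : ℝ) = n * r := by
    have := G.sum_degrees_eq_twice_card_edges
    simp only [hdeg _, Finset.sum_const, Finset.card_univ, smul_eq_mul] at this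
    exact_mod_cast this.symm
  have hE : ∑ i, ∑ j, adjWeight G i j * ‖f i - f j‖ ^ 2 ≤ n * (r * α ^ 2) := by
    have h1 : edgeAverageSq G f ≤ α ^ 2 := (Real.sqrt_le_iff.1 hedge).2
    have hpos : (0 : ℝ) < G.edgeFinset.card := by
      have : (0 : ℝ) < n * r := by positivity
      linarith
    rw [edgeAverageSq, one_div_mul_eq_div, div_le_iff₀ hpos] at h1
    rw [← sum_edgeFinset_eq G (fun i j => ‖f i - f j‖ ^ 2) fun i j => by simp only [norm_sub_rev]]
    nlinarith
  have hupper : √(pairAverage fun i j => ‖f i - f j‖ ^ 2) ≤ 2 * T * α := by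
    refine Real.sqrt_le_iff.2 ⟨by positivity, ?_⟩
    rw [pairAverage, ← hn, one_div_mul_eq_div, div_le_iff₀ (by positivity)]
    refine hP.trans ((mul_le_mul_of_nonneg_left (mul_le_mul_of_nonneg_left hE (sq_nonneg T))
      (by positivity)).trans_eq ?_)
    rw [← hn]
    have : (r : ℝ) ≠ 0 := by linarith
    field_simp
    ring
  have hmain : Real.log n / (6 * Real.log r) ≤ 2 * T * α := by linarith
  have hmain2 : Real.log n * (1 / 84 * gap / (α * Real.log r)) ≤ Real.log (2 * k) := by
    rw [div_le_iff₀ (by positivity)] at hmain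
    rw [mul_div_assoc', div_le_iff₀ (by positivity)]
    rw [hT] at hmain
    have h1 := mul_le_mul_of_nonneg_right hmain (show 0 ≤ 1 / 84 * gap by linarith)
    refine h1.trans_eq ?_
    field_simp
    ring
  have h3 : (n : ℝ) ^ (1 / 84 * gap / (α * Real.log r)) ≤ 2 * k := by
    rw [Real.rpow_def_of_pos (by linarith), ← Real.le_log_iff_exp_le (by linarith)]
    exact hmain2
  linarith

end Embedding

/-! ### Fourier analysis on the plane over a finite ring. -/

section Fourier

open ComplexConjugate

variable {R : Type} [CommRing R] [Fintype R]

/-- Parseval's identity for a primitive additive character. -/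
lemma sum_norm_sq_sum_addChar_mul {ψ : AddChar R ℂ} (hψ : ψ.IsPrimitive) (f : R → ℂ) :
    ∑ z, ‖∑ x, ψ (x * z) * f x‖ ^ 2 = Fintype.card R * ∑ x, ‖f x‖ ^ 2 := by
  classical
  have hc : ((∑ z, ‖∑ x, ψ (x * z) * f x‖ ^ 2 : ℝ) : ℂ) =
      ((Fintype.card R * ∑ x, ‖f x‖ ^ 2 : ℝ) : ℂ) := by
    push_cast
    have h1 : ∀ z, (‖∑ x, ψ (x * z) * f x‖ : ℂ) ^ 2 =
        ∑ x, ∑ y, f x * conj (f y) * ψ (z * (x - y)) := by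
      intro z
      rw [← Complex.mul_conj', map_sum, Finset.sum_mul_sum]
      refine Finset.sum_congr rfl fun x _ => Finset.sum_congr rfl fun y _ => ?_
      rw [map_mul (starRingEnd ℂ), ← AddChar.map_neg_eq_conj,
        show z * (x - y) = x * z + -(y * z) by ring, AddChar.map_add_eq_mul]
      ring
    rw [Finset.sum_congr rfl fun z _ => h1 z, Finset.sum_comm, Finset.mul_sum]
    refine Finset.sum_congr rfl fun x _ => ?_
    rw [Finset.sum_comm, Finset.sum_eq_single x]
    · rw [← Finset.mul_sum, AddChar.sum_mulShift _ hψ, sub_self, if_pos rfl, Complex.mul_conj']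
      ring
    · intro y _ hy
      rw [← Finset.mul_sum, AddChar.sum_mulShift _ hψ, if_neg (sub_ne_zero.2 hy.symm)]
      simp
    · simp
  exact_mod_cast hc

/-- The Fourier transform on `R × R` with respect to an additive character of `R`. -/
noncomputable def planeFourier (ψ : AddChar R ℂ) (f : R × R → ℂ) (z : R × R) : ℂ :=
  ∑ x, ψ (x.1 * z.1 + x.2 * z.2) * f x

lemma sum_norm_sq_planeFourier {ψ : AddChar R ℂ} (hψ : ψ.IsPrimitive) (f : R × R → ℂ) :
    ∑ z, ‖planeFourier ψ f z‖ ^ 2 = (Fintype.card R : ℝ) ^ 2 * ∑ x, ‖f x‖ ^ 2 := by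
  have h1 : ∀ z₁ z₂, planeFourier ψ f (z₁, z₂) =
      ∑ x₂, ψ (x₂ * z₂) * ∑ x₁, ψ (x₁ * z₁) * f (x₁, x₂) := by
    intro z₁ z₂
    rw [planeFourier, Fintype.sum_prod_type_right]
    refine Finset.sum_congr rfl fun x₂ _ => ?_
    rw [Finset.mul_sum]
    refine Finset.sum_congr rfl fun x₁ _ => ?_
    rw [AddChar.map_add_eq_mul]; ring
  simp only [Fintype.sum_prod_type, h1, sum_norm_sq_sum_addChar_mul hψ]
  rw [← Finset.mul_sum, Finset.sum_comm]
  simp only [sum_norm_sq_sum_addChar_mul hψ]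
  rw [← Finset.mul_sum, sq, mul_assoc, Finset.sum_comm]

lemma planeFourier_sub (ψ : AddChar R ℂ) (f g : R × R → ℂ) (z : R × R) :
    planeFourier ψ (f - g) z = planeFourier ψ f z - planeFourier ψ g z := by
  simp [planeFourier, mul_sub]

/-- The shear `(x, y) ↦ (x + y, y)`. -/
@[simps] def shearLeft (R : Type) [CommRing R] : Equiv.Perm (R × R) where
  toFun x := (x.1 + x.2, x.2)
  invFun x := (x.1 - x.2, x.2)
  left_inv x := by simp
  right_inv x := by simp

/-- The shear `(x, y) ↦ (x, y + x)`. -/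
@[simps] def shearRight (R : Type) [CommRing R] : Equiv.Perm (R × R) where
  toFun x := (x.1, x.2 + x.1)
  invFun x := (x.1, x.2 - x.1)
  left_inv x := by simp
  right_inv x := by simp

/-- The translation `(x, y) ↦ (x + 1, y)`. -/
@[simps] def shiftLeft (R : Type) [CommRing R] : Equiv.Perm (R × R) where
  toFun x := (x.1 + 1, x.2)
  invFun x := (x.1 - 1, x.2)
  left_inv x := by simp
  right_inv x := by simp

/-- The translation `(x, y) ↦ (x, y + 1)`. -/
@[simps] def shiftRight (R : Type) [CommRing R] : Equiv.Perm (R × R) where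
  toFun x := (x.1, x.2 + 1)
  invFun x := (x.1, x.2 - 1)
  left_inv x := by simp
  right_inv x := by simp

lemma planeFourier_comp_perm (ψ : AddChar R ℂ) (f : R × R → ℂ) (σ : Equiv.Perm (R × R))
    (z : R × R) : planeFourier ψ (fun x => f (σ x)) z =
      ∑ x, ψ ((σ.symm x).1 * z.1 + (σ.symm x).2 * z.2) * f x := by
  rw [planeFourier, ← Equiv.sum_comp σ
    fun x => ψ ((σ.symm x).1 * z.1 + (σ.symm x).2 * z.2) * f x]
  simp

/-- A linear change of variables acts on the dual side by its inverse transpose, which exchanges the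
two shears. -/
lemma planeFourier_comp_shearLeft (ψ : AddChar R ℂ) (f : R × R → ℂ) (z : R × R) :
    planeFourier ψ (fun x => f (shearLeft R x)) z =
      planeFourier ψ f ((shearRight R).symm z) := by
  rw [planeFourier_comp_perm, planeFourier]
  refine Finset.sum_congr rfl fun x _ => ?_
  simp only [shearLeft_symm_apply, shearRight_symm_apply]
  ring_nf

lemma planeFourier_comp_shearRight (ψ : AddChar R ℂ) (f : R × R → ℂ) (z : R × R) :
    planeFourier ψ (fun x => f (shearRight R x)) z =
      planeFourier ψ f ((shearLeft R).symm z) := by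
  rw [planeFourier_comp_perm, planeFourier]
  refine Finset.sum_congr rfl fun x _ => ?_
  simp only [shearLeft_symm_apply, shearRight_symm_apply]
  ring_nf

lemma planeFourier_comp_shiftLeft (ψ : AddChar R ℂ) (f : R × R → ℂ) (z : R × R) :
    planeFourier ψ (fun x => f (shiftLeft R x)) z = ψ (-z.1) * planeFourier ψ f z := by
  rw [planeFourier_comp_perm, planeFourier, Finset.mul_sum]
  refine Finset.sum_congr rfl fun x _ => ?_
  rw [← mul_assoc, ← AddChar.map_add_eq_mul]
  simp only [shiftLeft_symm_apply]
  ring_nf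

lemma planeFourier_comp_shiftRight (ψ : AddChar R ℂ) (f : R × R → ℂ) (z : R × R) :
    planeFourier ψ (fun x => f (shiftRight R x)) z = ψ (-z.2) * planeFourier ψ f z := by
  rw [planeFourier_comp_perm, planeFourier, Finset.mul_sum]
  refine Finset.sum_congr rfl fun x _ => ?_
  rw [← mul_assoc, ← AddChar.map_add_eq_mul]
  simp only [shiftRight_symm_apply]
  ring_nf

end Fourier

/-! ### Ping-pong on the dual of `(ℤ/m)²`. -/

section PingPong

variable {m : ℕ} [NeZero m]

/-- The squared chord is `2 - 2 cos θ`, and here `|θ|` lies in `[π/2, π]`. -/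
lemma two_le_norm_stdAddChar_sub_one_sq {z : ZMod m} (hz : (m : ℤ) ≤ 4 * |z.valMinAbs|) :
    2 ≤ ‖ZMod.stdAddChar (-z) - 1‖ ^ 2 := by
  set a := z.valMinAbs with ha
  have hm : (0 : ℝ) < m := by exact_mod_cast Nat.pos_of_ne_zero (NeZero.ne m)
  have hψ : ZMod.stdAddChar (-z) = Complex.exp ((2 * Real.pi * (-a) / m : ℝ) * Complex.I) := by
    have hz' : -z = ((-a : ℤ) : ZMod m) := by
      rw [Int.cast_neg, ha, ZMod.coe_valMinAbs]
    rw [hz', ZMod.stdAddChar_coe]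
    congr 1
    push_cast
    ring
  have hsq : ‖ZMod.stdAddChar (-z) - 1‖ ^ 2 = 2 - 2 * Real.cos (2 * Real.pi * (-a) / m) := by
    rw [hψ, ← Complex.normSq_eq_norm_sq, Complex.normSq_apply]
    simp only [Complex.sub_re, Complex.sub_im, Complex.exp_ofReal_mul_I_re,
      Complex.exp_ofReal_mul_I_im, Complex.one_re, Complex.one_im]
    nlinarith [Real.sin_sq_add_cos_sq (2 * Real.pi * (-a) / m)]
  have hcos : Real.cos (2 * Real.pi * (-a) / m) ≤ 0 := by
    have h1 : (m : ℝ) ≤ 4 * |(a : ℝ)| := by exact_mod_cast hz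
    have h2 : 2 * |(a : ℝ)| ≤ m := by
      have := z.natAbs_valMinAbs_le
      have h3 : 2 * a.natAbs ≤ m := by omega
      rw [← Int.cast_abs, Int.abs_eq_natAbs]
      exact_mod_cast h3
    rw [← Real.cos_abs]
    have h4 : |2 * Real.pi * (-(a : ℝ)) / m| = Real.pi * (2 * |(a : ℝ)| / m) := by
      rw [abs_div, abs_mul, abs_neg, abs_of_pos hm, abs_of_pos (by positivity)]
      ring
    rw [h4]
    have h5 : 1 / 2 ≤ 2 * |(a : ℝ)| / m := by
      rw [le_div_iff₀ hm]; linarith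
    have h6 : 2 * |(a : ℝ)| / m ≤ 1 := by
      rw [div_le_iff₀ hm]; linarith
    apply Real.cos_nonpos_of_pi_div_two_le_of_le <;> nlinarith [Real.pi_pos]
  rw [hsq]; linarith

/-- Nothing wraps around modulo `m`, so near the origin the shears act as on `ℤ²`. -/
lemma valMinAbs_add_of_small {x y : ZMod m} (hx : 4 * |x.valMinAbs| < m)
    (hy : 4 * |y.valMinAbs| < m) : (x + y).valMinAbs = x.valMinAbs + y.valMinAbs := by
  rw [ZMod.valMinAbs_spec]
  refine ⟨by simp, ?_⟩
  rw [Set.mem_Ioc]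
  have := abs_lt.1 (show |x.valMinAbs| < (m : ℤ) - 3 * |x.valMinAbs| by linarith)
  constructor
  · linarith [neg_abs_le x.valMinAbs, neg_abs_le y.valMinAbs]
  · linarith [le_abs_self x.valMinAbs, le_abs_self y.valMinAbs]

lemma valMinAbs_sub_of_small {x y : ZMod m} (hx : 4 * |x.valMinAbs| < m)
    (hy : 4 * |y.valMinAbs| < m) : (x - y).valMinAbs = x.valMinAbs - y.valMinAbs := by
  rw [ZMod.valMinAbs_spec]
  refine ⟨by simp, ?_⟩
  rw [Set.mem_Ioc]
  constructor
  · linarith [neg_abs_le x.valMinAbs, le_abs_self y.valMinAbs]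
  · linarith [le_abs_self x.valMinAbs, neg_abs_le y.valMinAbs]

open scoped Classical in
/-- The mass that the density `‖F‖²` gives to a set. -/
noncomputable def massOn {Y : Type} [Fintype Y] (F : Y → ℂ) (A : Set Y) : ℝ :=
  ∑ z, if z ∈ A then ‖F z‖ ^ 2 else 0

section Mass

variable {Y : Type} [Fintype Y] (F : Y → ℂ)

lemma massOn_le_add_add {A B C : Set Y} (h : A ⊆ B ∪ C) :
    massOn F A ≤ massOn F B + massOn F C := by
  classical
  rw [massOn, massOn, massOn, ← Finset.sum_add_distrib]
  refine Finset.sum_le_sum fun z _ => ?_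
  have := sq_nonneg ‖F z‖
  by_cases hA : z ∈ A
  · rcases h hA with hB | hC
    · simp only [hA, hB, if_true]; split_ifs <;> linarith
    · simp only [hA, hC, if_true]; split_ifs <;> linarith
  · simp only [hA, if_false]; split_ifs <;> linarith

lemma massOn_add_le {A B C : Set Y} (hAB : Disjoint A B) (hA : A ⊆ C) (hB : B ⊆ C) :
    massOn F A + massOn F B ≤ massOn F C := by
  classical
  rw [massOn, massOn, massOn, ← Finset.sum_add_distrib]
  refine Finset.sum_le_sum fun z _ => ?_
  have := sq_nonneg ‖F z‖
  by_cases h1 : z ∈ A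
  · have h2 : z ∉ B := fun h => Set.disjoint_left.1 hAB h1 h
    simp [h1, h2, hA h1]
  · by_cases h2 : z ∈ B
    · simp [h1, h2, hB h2]
    · simp only [h1, h2, if_false]; split_ifs <;> linarith

/-- Uses `(u + v)² ≤ (3/2) u² + 3 v²`. A leading constant below `2` is what lets ping-pong close. -/
lemma massOn_le_of_mapsTo {A B : Set Y} (T : Equiv.Perm Y) (h : ∀ z ∈ A, T z ∈ B) :
    massOn F A ≤ 3 / 2 * massOn F B + 3 * ∑ z, ‖F (T z) - F z‖ ^ 2 := by
  classical
  have h1 : massOn F B = ∑ z, if T z ∈ B then ‖F (T z)‖ ^ 2 else 0 :=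
    (Equiv.sum_comp T fun z => if z ∈ B then ‖F z‖ ^ 2 else 0).symm
  rw [h1, massOn, Finset.mul_sum, Finset.mul_sum, ← Finset.sum_add_distrib]
  refine Finset.sum_le_sum fun z _ => ?_
  by_cases hA : z ∈ A
  · simp only [hA, h z hA, if_true]
    have h2 : ‖F z‖ ≤ ‖F (T z)‖ + ‖F (T z) - F z‖ := by
      have := norm_sub_le (F (T z)) (F (T z) - F z)
      simpa using this
    refine (pow_le_pow_left₀ (norm_nonneg _) h2 2).trans ?_
    nlinarith [sq_nonneg (‖F (T z)‖ - 2 * ‖F (T z) - F z‖)]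
  · simp only [hA, if_false]
    split_ifs <;> positivity

lemma massOn_le_of_mapsTo_symm {A B : Set Y} (T : Equiv.Perm Y) (h : ∀ z ∈ A, T.symm z ∈ B) :
    massOn F A ≤ 3 / 2 * massOn F B + 3 * ∑ z, ‖F (T z) - F z‖ ^ 2 := by
  refine (massOn_le_of_mapsTo F T.symm h).trans_eq ?_
  rw [← Equiv.sum_comp T fun z => ‖F (T.symm z) - F z‖ ^ 2]
  simp [norm_sub_rev]

end Mass

/-- A function on the dual of `(ℤ/m)²` which vanishes at the origin, is concentrated near it and is
nearly invariant under the two elementary shears is small: ping-pong on the four quadrants. -/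
lemma sum_norm_sq_le_of_shears {F : ZMod m × ZMod m → ℂ} (h0 : F 0 = 0) {D : ℝ}
    (hL : ∑ z, ‖F (shearLeft _ z) - F z‖ ^ 2 ≤ D) (hR : ∑ z, ‖F (shearRight _ z) - F z‖ ^ 2 ≤ D)
    (h1 : ∑ z, ‖ZMod.stdAddChar (-z.1) - 1‖ ^ 2 * ‖F z‖ ^ 2 ≤ D)
    (h2 : ∑ z, ‖ZMod.stdAddChar (-z.2) - 1‖ ^ 2 * ‖F z‖ ^ 2 ≤ D) :
    ∑ z, ‖F z‖ ^ 2 ≤ 86 * D := by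
  classical
  let a : ZMod m × ZMod m → ℤ := fun z => z.1.valMinAbs
  let b : ZMod m × ZMod m → ℤ := fun z => z.2.valMinAbs
  let Q : Set (ZMod m × ZMod m) := {z | 4 * |a z| < m ∧ 4 * |b z| < m}
  let P : Set (ZMod m × ZMod m) := {z | 0 < a z * b z}
  let N : Set (ZMod m × ZMod m) := {z | a z * b z < 0}
  let big : Set (ZMod m × ZMod m) := {z | |b z| < |a z|}
  let small : Set (ZMod m × ZMod m) := {z | |a z| < |b z|}
  let H : Set (ZMod m × ZMod m) := {z | z.2 = 0 ∧ z.1 ≠ 0}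
  let W : Set (ZMod m × ZMod m) := {z | z.1 = 0 ∧ z.2 ≠ 0}
  -- Away from the origin one of the two characters is far from `1`, so near invariance under
  -- translations leaves little mass.
  have hQc : massOn F Qᶜ ≤ D := by
    have h3 : 2 * massOn F Qᶜ ≤ ∑ z, ‖ZMod.stdAddChar (-z.1) - 1‖ ^ 2 * ‖F z‖ ^ 2 +
        ∑ z, ‖ZMod.stdAddChar (-z.2) - 1‖ ^ 2 * ‖F z‖ ^ 2 := by
      rw [massOn, Finset.mul_sum, ← Finset.sum_add_distrib]
      refine Finset.sum_le_sum fun z _ => ?_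
      by_cases hz : z ∈ Qᶜ
      · rw [if_pos hz, ← add_mul]
        refine mul_le_mul_of_nonneg_right ?_ (sq_nonneg _)
        have hz' : ¬ (4 * |a z| < m ∧ 4 * |b z| < m) := hz
        rcases not_and_or.1 hz' with h | h
        · have := two_le_norm_stdAddChar_sub_one_sq (not_lt.1 h)
          linarith [sq_nonneg ‖ZMod.stdAddChar (-z.2) - 1‖]
        · have := two_le_norm_stdAddChar_sub_one_sq (not_lt.1 h)
          linarith [sq_nonneg ‖ZMod.stdAddChar (-z.1) - 1‖]
      · rw [if_neg hz, mul_zero]; positivity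
    linarith
  have hsplit : ∀ A : Set (ZMod m × ZMod m), massOn F A ≤ massOn F (A ∩ Q) + massOn F Qᶜ :=
    fun A => massOn_le_add_add F fun z hz => by
      by_cases h : z ∈ Q
      · exact Or.inl ⟨hz, h⟩
      · exact Or.inr h
  have hdisj : ∀ A : Set (ZMod m × ZMod m), massOn F (A ∩ big) + massOn F (A ∩ small) ≤
      massOn F A := fun A => massOn_add_le F
    (Set.disjoint_left.2 fun z h h' => lt_asymm (show |b z| < |a z| from h.2) h'.2)
    Set.inter_subset_left Set.inter_subset_left
  have hP : massOn F P ≤ 16 * D := by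
    -- The two shears send `P ∩ Q` into disjoint parts of `P`. Adding the estimates gives `2 |P ∩ Q|
    -- ≤ (3/2) |P| + 6D`; with `|P| ≤ |P ∩ Q| + D` this yields `|P| ≤ 16D`, where `|·|` is mass.
    have h3 : massOn F (P ∩ Q) ≤ 3 / 2 * massOn F (P ∩ big) + 3 * D := by
      refine (massOn_le_of_mapsTo F (B := P ∩ big) (shearLeft _) fun z hz => ?_).trans (by linarith)
      have hz1 : 0 < a z * b z := hz.1
      have ha : a (shearLeft _ z) = a z + b z := valMinAbs_add_of_small hz.2.1 hz.2.2
      have hb : b (shearLeft _ z) = b z := rfl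
      constructor
      · change 0 < a _ * b _
        rw [ha, hb]; nlinarith [sq_nonneg (b z)]
      · change |b _| < |a _|
        rw [ha, hb, ← sq_lt_sq]; nlinarith [sq_pos_of_ne_zero (left_ne_zero_of_mul hz1.ne')]
    have h4 : massOn F (P ∩ Q) ≤ 3 / 2 * massOn F (P ∩ small) + 3 * D := by
      refine (massOn_le_of_mapsTo F (B := P ∩ small) (shearRight _) fun z hz => ?_).trans (by linarith)
      have hz1 : 0 < a z * b z := hz.1
      have hb : b (shearRight _ z) = b z + a z := valMinAbs_add_of_small hz.2.2 hz.2.1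
      have ha : a (shearRight _ z) = a z := rfl
      constructor
      · change 0 < a _ * b _
        rw [ha, hb]; nlinarith [sq_nonneg (a z)]
      · change |a _| < |b _|
        rw [ha, hb, ← sq_lt_sq]; nlinarith [sq_pos_of_ne_zero (right_ne_zero_of_mul hz1.ne')]
    linarith [hsplit P, hdisj P]
  have hN : massOn F N ≤ 16 * D := by
    have h3 : massOn F (N ∩ Q) ≤ 3 / 2 * massOn F (N ∩ big) + 3 * D := by
      -- For coordinates of opposite signs it is the inverse shears that expand.
      refine (massOn_le_of_mapsTo_symm F (B := N ∩ big) (shearLeft _) fun z hz => ?_).trans (by linarith)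
      have hz1 : a z * b z < 0 := hz.1
      have ha : a ((shearLeft _).symm z) = a z - b z := valMinAbs_sub_of_small hz.2.1 hz.2.2
      have hb : b ((shearLeft _).symm z) = b z := rfl
      constructor
      · change a _ * b _ < 0
        rw [ha, hb]; nlinarith [sq_nonneg (b z)]
      · change |b _| < |a _|
        rw [ha, hb, ← sq_lt_sq]; nlinarith [sq_pos_of_ne_zero (left_ne_zero_of_mul hz1.ne)]
    have h4 : massOn F (N ∩ Q) ≤ 3 / 2 * massOn F (N ∩ small) + 3 * D := by
      refine (massOn_le_of_mapsTo_symm F (B := N ∩ small) (shearRight _) fun z hz => ?_).trans (by linarith)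
      have hz1 : a z * b z < 0 := hz.1
      have hb : b ((shearRight _).symm z) = b z - a z := valMinAbs_sub_of_small hz.2.2 hz.2.1
      have ha : a ((shearRight _).symm z) = a z := rfl
      constructor
      · change a _ * b _ < 0
        rw [ha, hb]; nlinarith [sq_nonneg (a z)]
      · change |a _| < |b _|
        rw [ha, hb, ← sq_lt_sq]; nlinarith [sq_pos_of_ne_zero (right_ne_zero_of_mul hz1.ne)]
    linarith [hsplit N, hdisj N]
  have hH : massOn F H ≤ 27 * D := by
    -- A shear sends `(a, 0)` to `(a, a)`, which lies in `P` without any smallness; thus `27 = (3/2)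
    -- · 16 + 3`.
    have : massOn F H ≤ 3 / 2 * massOn F P + 3 * D := by
      refine (massOn_le_of_mapsTo F (B := P) (shearRight _) fun z hz => ?_).trans (by linarith)
      have hz1 : z.2 = 0 := hz.1
      have hz2 : a z ≠ 0 := mt (ZMod.valMinAbs_eq_zero _).1 hz.2
      have hb : b (shearRight _ z) = a z := by simp [a, b, hz1]
      have ha : a (shearRight _ z) = a z := rfl
      change 0 < a _ * b _
      rw [ha, hb]
      exact mul_self_pos.2 hz2
    linarith
  have hW : massOn F W ≤ 27 * D := by
    have : massOn F W ≤ 3 / 2 * massOn F P + 3 * D := by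
      refine (massOn_le_of_mapsTo F (B := P) (shearLeft _) fun z hz => ?_).trans (by linarith)
      have hz1 : z.1 = 0 := hz.1
      have hz2 : b z ≠ 0 := mt (ZMod.valMinAbs_eq_zero _).1 hz.2
      have ha : a (shearLeft _ z) = b z := by simp [a, b, hz1]
      have hb : b (shearLeft _ z) = b z := rfl
      change 0 < a _ * b _
      rw [ha, hb]
      exact mul_self_pos.2 hz2
    linarith
  have htot : ∑ z, ‖F z‖ ^ 2 ≤ massOn F ((P ∪ N) ∪ (H ∪ W)) := by
    refine Finset.sum_le_sum fun z _ => ?_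
    rcases eq_or_ne z 0 with rfl | hz
    · rw [h0]; simp
    rw [if_pos]
    by_cases hz1 : z.1 = 0
    · have hz2 : z.2 ≠ 0 := fun h => hz (Prod.ext hz1 h)
      exact Or.inr (Or.inr ⟨hz1, hz2⟩)
    by_cases hz2 : z.2 = 0
    · exact Or.inr (Or.inl ⟨hz2, hz1⟩)
    have : a z * b z ≠ 0 := mul_ne_zero (mt (ZMod.valMinAbs_eq_zero _).1 hz1)
      (mt (ZMod.valMinAbs_eq_zero _).1 hz2)
    rcases this.lt_or_gt with h | h
    · exact Or.inl (Or.inr h)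
    · exact Or.inl (Or.inl h)
  have h3 := massOn_le_add_add F (subset_refl ((P ∪ N) ∪ (H ∪ W)))
  have h4 := massOn_le_add_add F (subset_refl (P ∪ N))
  have h5 := massOn_le_add_add F (subset_refl (H ∪ W))
  linarith

/-- The Poincaré inequality for the action of two shears and two translations on `(ℤ/m)²`. -/
theorem sum_sq_le_of_plane_action {f : ZMod m × ZMod m → ℝ} (hf : ∑ x, f x = 0) {D : ℝ}
    (hL : ∑ x, (f (shearLeft _ x) - f x) ^ 2 ≤ D) (hR : ∑ x, (f (shearRight _ x) - f x) ^ 2 ≤ D)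
    (h1 : ∑ x, (f (shiftLeft _ x) - f x) ^ 2 ≤ D)
    (h2 : ∑ x, (f (shiftRight _ x) - f x) ^ 2 ≤ D) : ∑ x, f x ^ 2 ≤ 86 * D := by
  have hψ := ZMod.isPrimitive_stdAddChar m
  have hm : (0 : ℝ) < (Fintype.card (ZMod m) : ℝ) ^ 2 := by
    have : 0 < Fintype.card (ZMod m) := Fintype.card_pos
    positivity
  let g : ZMod m × ZMod m → ℂ := fun x => f x
  let F := planeFourier (ZMod.stdAddChar (N := m)) g
  have key : ∀ σ : Equiv.Perm (ZMod m × ZMod m), ∑ x, (f (σ x) - f x) ^ 2 ≤ D →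
      ∑ z, ‖planeFourier ZMod.stdAddChar (fun x => g (σ x)) z - F z‖ ^ 2 ≤
        (Fintype.card (ZMod m) : ℝ) ^ 2 * D := by
    intro σ hσ
    simp only [F, ← planeFourier_sub]
    rw [sum_norm_sq_planeFourier hψ]
    refine mul_le_mul_of_nonneg_left (le_of_eq_of_le ?_ hσ) hm.le
    refine Finset.sum_congr rfl fun x _ => ?_
    simp only [Pi.sub_apply, g, ← Complex.ofReal_sub, Complex.norm_real, Real.norm_eq_abs, sq_abs]
  have hF0 : F 0 = 0 := by
    simp only [F, planeFourier, Prod.fst_zero, Prod.snd_zero, mul_zero, add_zero,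
      AddChar.map_zero_eq_one, one_mul, g]
    exact_mod_cast hf
  -- The dual shears appear inverted; reindexing shows that the displacement is the same.
  have hswap : ∀ σ : Equiv.Perm (ZMod m × ZMod m),
      ∑ z, ‖F (σ z) - F z‖ ^ 2 = ∑ z, ‖F (σ.symm z) - F z‖ ^ 2 := by
    intro σ
    rw [← Equiv.sum_comp σ fun z => ‖F (σ.symm z) - F z‖ ^ 2]
    simp [norm_sub_rev]
  have hmain : ∑ z, ‖F z‖ ^ 2 ≤ 86 * ((Fintype.card (ZMod m) : ℝ) ^ 2 * D) := by
    refine sum_norm_sq_le_of_shears hF0 ?_ ?_ ?_ ?_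
    · have := key _ hR
      simp only [planeFourier_comp_shearRight] at this
      rw [hswap]; exact this
    · have := key _ hL
      simp only [planeFourier_comp_shearLeft] at this
      rw [hswap]; exact this
    · have := key _ h1
      simp only [planeFourier_comp_shiftLeft] at this
      refine le_of_eq_of_le (Finset.sum_congr rfl fun z _ => ?_) this
      rw [← mul_pow, ← norm_mul, sub_mul, one_mul]
    · have := key _ h2
      simp only [planeFourier_comp_shiftRight] at this
      refine le_of_eq_of_le (Finset.sum_congr rfl fun z _ => ?_) this
      rw [← mul_pow, ← norm_mul, sub_mul, one_mul]
  rw [sum_norm_sq_planeFourier hψ, mul_left_comm] at hmain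
  have := le_of_mul_le_mul_left hmain hm
  simpa [g] using this

end PingPong

/-! ### From a scalar Poincaré inequality to connectedness and a spectral gap. -/

section ExpandersFromPoincare

variable {V : Type} [Fintype V] [DecidableEq V] (G : SimpleGraph V) [DecidableRel G.Adj]

omit [DecidableEq V] in
-- The centred indicator of a connected component has zero gradient, so it vanishes and the
-- component is everything.
lemma connected_of_sum_sq_le [Nonempty V] {K : ℝ}
    (h : ∀ F : V → ℝ, ∑ v, F v = 0 →
      ∑ v, F v ^ 2 ≤ K * ∑ p, ∑ q, adjWeight G p q * (F p - F q) ^ 2) : G.Connected := by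
  classical
  refine SimpleGraph.connected_iff_exists_forall_reachable G |>.2 ⟨Classical.arbitrary V, ?_⟩
  set u := Classical.arbitrary V
  let g : V → ℝ := fun v => if G.Reachable u v then 1 else 0
  set c : ℝ := (∑ v, g v) / Fintype.card V with hc
  have hcard : (Fintype.card V : ℝ) ≠ 0 := by exact_mod_cast Fintype.card_ne_zero
  have h1 := h (fun v => g v - c) (by
    rw [Finset.sum_sub_distrib, Finset.sum_const, Finset.card_univ, nsmul_eq_mul, hc]
    field_simp; ring)
  have h2 : ∑ p, ∑ q, adjWeight G p q * (g p - c - (g q - c)) ^ 2 = 0 := by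
    refine Finset.sum_eq_zero fun p _ => Finset.sum_eq_zero fun q _ => ?_
    by_cases hpq : G.Adj p q
    · have : G.Reachable u p ↔ G.Reachable u q :=
        ⟨fun h => h.trans hpq.reachable, fun h => h.trans hpq.symm.reachable⟩
      simp [g, this]
    · simp [adjWeight, hpq]
  rw [h2, mul_zero] at h1
  have h3 := (Finset.sum_eq_zero_iff_of_nonneg fun v _ => sq_nonneg (g v - c)).1
    (le_antisymm h1 (Finset.sum_nonneg fun v _ => sq_nonneg _))
  have h4 : ∀ v, g v = c := fun v => sub_eq_zero.1 (pow_eq_zero_iff two_ne_zero |>.1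
    (h3 v (Finset.mem_univ v)))
  intro v
  have h5 : g v = g u := (h4 v).trans (h4 u).symm
  by_contra hv
  simp [g, hv] at h5

lemma graphLambda2_le_of_sum_sq_le (hV : 2 ≤ Fintype.card V) {r : ℕ} (hr : 0 < r)
    (hdeg : G.IsRegularOfDegree r) {K : ℝ} (hK : 0 < K)
    (h : ∀ F : V → ℝ, ∑ v, F v = 0 →
      ∑ v, F v ^ 2 ≤ K * ∑ p, ∑ q, adjWeight G p q * (F p - F q) ^ 2) :
    graphLambda2 G ≤ 1 - 1 / (2 * K * r) := by
  have hr' : (0 : ℝ) < r := by exact_mod_cast hr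
  rw [graphLambda2_eq_secondEigenvalue]
  have hd : ∀ i, ∑ k, adjWeight G i k = r := fun i => by rw [sum_adjWeight, hdeg i]
  refine secondEigenvalue_le_of_sum_sum_mul_le (adjWeight_comm G)
    (fun i => by rw [hd]; exact hr') hV fun g hg => ?_
  simp only [hd, ← Finset.mul_sum] at hg ⊢
  have h1 := h g ((mul_eq_zero.1 hg).resolve_left hr'.ne')
  have h2 : ∑ p, ∑ q, adjWeight G p q * (g p - g q) ^ 2 =
      2 * (r * ∑ v, g v ^ 2) - 2 * ∑ i, ∑ j, adjWeight G i j * (g i * g j) := by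
    have e : ∀ p q, adjWeight G p q * (g p - g q) ^ 2 = adjWeight G p q * g p ^ 2 +
        adjWeight G p q * g q ^ 2 - 2 * (adjWeight G p q * (g p * g q)) := fun p q => by ring
    simp only [e, Finset.sum_sub_distrib, Finset.sum_add_distrib, ← Finset.mul_sum]
    rw [sum_sum_mul_sq_right (adjWeight_comm G) fun i => g i ^ 2]
    simp only [← Finset.sum_mul, hd, ← Finset.mul_sum]
    ring
  rw [h2] at h1
  have h3 : (1 - 1 / (2 * K * r)) * (r * ∑ v, g v ^ 2) =
      r * ∑ v, g v ^ 2 - (∑ v, g v ^ 2) / (2 * K) := by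
    field_simp
  rw [h3]
  have h4 : (∑ v, g v ^ 2) / (2 * K) ≤
      r * ∑ v, g v ^ 2 - ∑ i, ∑ j, adjWeight G i j * (g i * g j) := by
    rw [div_le_iff₀ (by positivity)]; linarith
  linarith

end ExpandersFromPoincare

/-! ### Lifts of complete graphs. -/

section CompleteLift

variable {Y : Type} {k : ℕ}

/-- The lift of the complete graph on `k` layers along permutations `τ a b`, `a < b`, of the
fibre `Y`. -/
def completeLift (τ : Fin k → Fin k → Equiv.Perm Y) : SimpleGraph (Y × Fin k) where
  Adj p q := (p.2 < q.2 ∧ τ p.2 q.2 p.1 = q.1) ∨ (q.2 < p.2 ∧ τ q.2 p.2 q.1 = p.1)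
  symm := ⟨fun _ _ h => h.symm⟩
  loopless := ⟨fun _ h => by rcases h with h | h <;> exact lt_irrefl _ h.1⟩

variable (τ : Fin k → Fin k → Equiv.Perm Y)

lemma completeLift_adj_of_lt {a b : Fin k} (hab : a < b) (x : Y) :
    (completeLift τ).Adj (x, a) (τ a b x, b) := Or.inl ⟨hab, rfl⟩

variable [Fintype Y] [DecidableEq Y]

instance : DecidableRel (completeLift τ).Adj := fun p q =>
  inferInstanceAs (Decidable ((p.2 < q.2 ∧ τ p.2 q.2 p.1 = q.1) ∨
    (q.2 < p.2 ∧ τ q.2 p.2 q.1 = p.1)))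

/-- Each vertex has exactly one neighbour in every other layer. Fixed points or coincidences of the
permutations therefore create no loops or multiple edges. -/
lemma completeLift_isRegularOfDegree : (completeLift τ).IsRegularOfDegree (k - 1) := by
  rintro ⟨x, a⟩
  rw [← SimpleGraph.card_neighborFinset_eq_degree]
  have hc : (Finset.univ.erase a).card = k - 1 := by
    rw [Finset.card_erase_of_mem (Finset.mem_univ a), Finset.card_univ, Fintype.card_fin]
  rw [← hc]
  symm
  refine Finset.card_bij (fun b _ => ((if a < b then τ a b x else (τ b a).symm x), b)) ?_ ?_ ?_
  · intro b hb
    rw [SimpleGraph.mem_neighborFinset]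
    rcases (Finset.ne_of_mem_erase hb).lt_or_gt with h | h
    · exact Or.inr ⟨h, by simp [h.not_gt]⟩
    · exact Or.inl ⟨h, by simp [h]⟩
  · intro b _ b' _ h
    exact (Prod.ext_iff.1 h).2
  · rintro ⟨y, b⟩ hy
    rw [SimpleGraph.mem_neighborFinset] at hy
    rcases hy with ⟨h, h2⟩ | ⟨h, h2⟩
    · refine ⟨b, by simpa using h.ne', ?_⟩
      simp only at h h2
      simp [h, h2]
    · refine ⟨b, by simpa using h.ne, ?_⟩
      simp only at h h2
      simp [h.not_gt, ← h2]

lemma sum_layer_sq_le (F : Y × Fin k → ℝ) {a b : Fin k} (hab : a < b) :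
    ∑ x, (F (x, a) - F (τ a b x, b)) ^ 2 ≤
      ∑ p, ∑ q, adjWeight (completeLift τ) p q * (F p - F q) ^ 2 := by
  have hnn : ∀ p q, 0 ≤ adjWeight (completeLift τ) p q * (F p - F q) ^ 2 := fun p q =>
    mul_nonneg (adjWeight_nonneg _ _ _) (sq_nonneg _)
  rw [Fintype.sum_prod_type]
  refine Finset.sum_le_sum fun x _ => ?_
  refine le_trans ?_ (Finset.single_le_sum
    (f := fun c => ∑ q, adjWeight (completeLift τ) (x, c) q * (F (x, c) - F q) ^ 2)
    (fun c _ => Finset.sum_nonneg fun q _ => hnn _ q) (Finset.mem_univ a))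
  refine le_trans ?_ (Finset.single_le_sum
    (f := fun q => adjWeight (completeLift τ) (x, a) q * (F (x, a) - F q) ^ 2)
    (fun q _ => hnn _ q) (Finset.mem_univ (τ a b x, b)))
  simp [adjWeight, completeLift_adj_of_lt τ hab x]

end CompleteLift

/-! ### The 4-regular expanders. -/

section PlaneExpander

variable {m : ℕ} [NeZero m]

/-- Permutations of `(ℤ/m)²` indexed by pairs of layers: the four generators of the affine action
are used between the layers `1, …, 4`, and the identity elsewhere. -/
def planePerm (m : ℕ) (a b : Fin 5) : Equiv.Perm (ZMod m × ZMod m) :=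
  if a = 1 ∧ b = 2 then shearLeft _ else
  if a = 1 ∧ b = 3 then shearRight _ else
  if a = 1 ∧ b = 4 then shiftLeft _ else
  if a = 2 ∧ b = 3 then shiftRight _ else 1

omit [NeZero m] in
lemma planePerm_zero (b : Fin 5) : planePerm m 0 b = 1 := by
  simp [planePerm]

/-- Identity edges keep every layer close to layer `0`; the other edges then make layer `0` nearly
invariant under the four generators. The final constant is `5 (2 + 2 · 86 · 9) = 7750`. -/
lemma sum_sq_le_of_completeLift {F : (ZMod m × ZMod m) × Fin 5 → ℝ} (hF : ∑ p, F p = 0) :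
    ∑ p, F p ^ 2 ≤
      10000 * ∑ p, ∑ q, adjWeight (completeLift (planePerm m)) p q * (F p - F q) ^ 2 := by
  set E := ∑ p, ∑ q, adjWeight (completeLift (planePerm m)) p q * (F p - F q) ^ 2 with hE
  have hE0 : 0 ≤ E := Finset.sum_nonneg fun p _ => Finset.sum_nonneg fun q _ =>
    mul_nonneg (adjWeight_nonneg _ _ _) (sq_nonneg _)
  let f : ZMod m × ZMod m → ℝ := fun x => F (x, 0)
  have hlayer : ∀ b, ∑ x, (f x - F (x, b)) ^ 2 ≤ E := by
    intro b
    rcases eq_or_ne b 0 with rfl | hb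
    · simpa [f] using hE0
    · have := sum_layer_sq_le (planePerm m) F (Fin.pos_of_ne_zero hb)
      simpa [planePerm_zero] using this
  -- Go from `(x, 0)` up to layer `a`, across to layer `b`, and down to `(σ x, 0)`: three steps,
  -- each of energy at most `E`.
  have hgen : ∀ a b : Fin 5, a < b → ∑ x, (f (planePerm m a b x) - f x) ^ 2 ≤ 9 * E := by
    intro a b hab
    set σ := planePerm m a b
    have h1 := sum_layer_sq_le (planePerm m) F hab
    have h2 : ∑ x, (f (σ x) - F (σ x, b)) ^ 2 ≤ E := by
      rw [Equiv.sum_comp σ fun x => (f x - F (x, b)) ^ 2]; exact hlayer b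
    have h3 := hlayer a
    have : ∑ x, (f (σ x) - f x) ^ 2 ≤ ∑ x, (3 * (F (x, a) - F (σ x, b)) ^ 2 +
        3 * (f (σ x) - F (σ x, b)) ^ 2 + 3 * (f x - F (x, a)) ^ 2) := by
      refine Finset.sum_le_sum fun x _ => ?_
      nlinarith [sq_nonneg ((f x - F (x, a)) - (F (x, a) - F (σ x, b))),
        sq_nonneg ((F (x, a) - F (σ x, b)) + (f (σ x) - F (σ x, b))),
        sq_nonneg ((f x - F (x, a)) + (f (σ x) - F (σ x, b)))]
    refine this.trans ?_
    rw [Finset.sum_add_distrib, Finset.sum_add_distrib, ← Finset.mul_sum, ← Finset.mul_sum,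
      ← Finset.mul_sum]
    linarith
  set N : ℝ := (Fintype.card (ZMod m × ZMod m) : ℝ) with hN
  have hN0 : N ≠ 0 := by
    rw [hN]; exact_mod_cast Fintype.card_ne_zero
  set c : ℝ := (∑ x, f x) / N with hc
  have hvar : ∑ x, (f x - c) ^ 2 ≤ 86 * (9 * E) := by
    refine sum_sq_le_of_plane_action (f := fun x => f x - c) ?_ ?_ ?_ ?_ ?_
    · rw [Finset.sum_sub_distrib, Finset.sum_const, Finset.card_univ, nsmul_eq_mul, ← hN, hc]
      field_simp; ring
    · simpa [planePerm] using hgen 1 2 (by decide)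
    · simpa [planePerm] using hgen 1 3 (by decide)
    · simpa [planePerm] using hgen 1 4 (by decide)
    · simpa [planePerm] using hgen 2 3 (by decide)
  have hcen : ∑ p, F p ^ 2 ≤ ∑ p, (F p - c) ^ 2 := by
    have : ∑ p, (F p - c) ^ 2 = ∑ p, F p ^ 2 - 2 * c * ∑ p, F p +
        Fintype.card ((ZMod m × ZMod m) × Fin 5) * c ^ 2 := by
      rw [Finset.mul_sum, ← Finset.sum_sub_distrib, ← Finset.card_univ, ← nsmul_eq_mul,
        ← Finset.sum_const, ← Finset.sum_add_distrib]
      exact Finset.sum_congr rfl fun p _ => by ring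
    rw [this, hF]
    have : 0 ≤ Fintype.card ((ZMod m × ZMod m) × Fin 5) * c ^ 2 := by positivity
    linarith
  refine hcen.trans ?_
  rw [Fintype.sum_prod_type_right]
  have hb : ∀ b, ∑ x, (F (x, b) - c) ^ 2 ≤ 2 * E + 2 * (86 * (9 * E)) := by
    intro b
    have : ∑ x, (F (x, b) - c) ^ 2 ≤ ∑ x, (2 * (f x - F (x, b)) ^ 2 + 2 * (f x - c) ^ 2) :=
      Finset.sum_le_sum fun x _ => by
        nlinarith [sq_nonneg ((f x - F (x, b)) + (f x - c))]
    refine this.trans ?_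
    rw [Finset.sum_add_distrib, ← Finset.mul_sum, ← Finset.mul_sum]
    linarith [hlayer b]
  refine (Finset.sum_le_card_nsmul _ _ _ fun b _ => hb b).trans ?_
  simp only [Finset.card_univ, Fintype.card_fin, nsmul_eq_mul]
  push_cast
  linarith

/-- Arbitrarily large `4`-regular spectral expanders exist. -/
theorem exists_four_regular_expander (N : ℕ) : ∃ n : ℕ, N ≤ n ∧ 2 ≤ n ∧
    ∃ (G : SimpleGraph (Fin n)) (_ : DecidableRel G.Adj),
      G.Connected ∧ G.IsRegularOfDegree 4 ∧ graphLambda2 G ≤ 1 - 1 / 80000 := by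
  let V := (ZMod (N + 1) × ZMod (N + 1)) × Fin 5
  have hcard : Fintype.card V = (N + 1) * (N + 1) * 5 := by
    simp [V, ZMod.card]
  let e : Fin (Fintype.card V) ≃ V := (Fintype.equivFin V).symm
  let G₀ : SimpleGraph V := completeLift (planePerm (N + 1))
  let G := G₀.comap e
  have hn : N ≤ Fintype.card V ∧ 2 ≤ Fintype.card V := by
    rw [hcard]; constructor <;> nlinarith
  have hP : ∀ F : Fin (Fintype.card V) → ℝ, ∑ v, F v = 0 →
      ∑ v, F v ^ 2 ≤ 10000 * ∑ p, ∑ q, adjWeight G p q * (F p - F q) ^ 2 := by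
    intro F hF
    have h1 := sum_sq_le_of_completeLift (m := N + 1) (F := fun v => F (e.symm v))
      (by rw [Equiv.sum_comp e.symm]; exact hF)
    rw [Equiv.sum_comp e.symm fun v => F v ^ 2] at h1
    refine h1.trans_eq ?_
    congr 1
    rw [← Equiv.sum_comp e]
    refine Finset.sum_congr rfl fun p _ => ?_
    rw [← Equiv.sum_comp e]
    refine Finset.sum_congr rfl fun q _ => ?_
    simp only [Equiv.symm_apply_apply]
    rfl
  have hreg : G.IsRegularOfDegree 4 := by
    intro v
    have := completeLift_isRegularOfDegree (planePerm (N + 1)) (e v)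
    exact ((SimpleGraph.Iso.comap e G₀).degree_eq v).symm.trans this
  have : Nonempty (Fin (Fintype.card V)) := ⟨⟨0, by omega⟩⟩
  refine ⟨Fintype.card V, hn.1, hn.2, G, inferInstance, connected_of_sum_sq_le G hP, hreg, ?_⟩
  -- The gap is `1 / (2 · 10000 · 4)`.
  have := graphLambda2_le_of_sum_sq_le G (by simpa using hn.2) (by norm_num) hreg
    (by norm_num) hP
  refine this.trans_eq ?_
  norm_num

end PlaneExpander

/-- The shortest-path metric of a connected graph. -/
noncomputable abbrev SimpleGraph.Connected.distMetricSpace {V : Type} {G : SimpleGraph V}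
    (hG : G.Connected) : MetricSpace V where
  dist x y := graphDist G x y
  dist_self x := by simp [graphDist]
  dist_comm x y := by simp [graphDist, G.dist_comm]
  dist_triangle x y z := by
    simp only [graphDist]
    exact_mod_cast hG.dist_triangle
  eq_of_dist_eq_zero {x y} h := by
    simp only [graphDist, Nat.cast_eq_zero] at h
    exact (hG.dist_eq_zero_iff).1 h

theorem theorem1p8 :
    -- arbitrarily large metric spaces that are high dimensional on average
    (∃ c : ℝ, 0 < c ∧ ∀ N : ℕ, ∃ n : ℕ, N ≤ n ∧
      ∃ (M : Type) (_ : Fintype M) (_ : MetricSpace M), Fintype.card M = n ∧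
        ForcesAverageDimension.{u} (fun x y : M => dist x y) c) ∧
    -- arbitrarily large regular spectral expanders of a fixed degree exist
    (∃ (r : ℕ) (ε : ℝ), 3 ≤ r ∧ 0 < ε ∧ ∀ N : ℕ, ∃ n : ℕ, N ≤ n ∧
      ∃ (G : SimpleGraph (Fin n)) (_ : DecidableRel G.Adj),
        G.Connected ∧ G.IsRegularOfDegree r ∧ graphLambda2 G ≤ 1 - ε) ∧
    -- every bounded-degree spectral expander is such a metric space
    (∀ (r : ℕ) (ε : ℝ), 0 < ε → ∃ c : ℝ, 0 < c ∧
      ∀ (n : ℕ) (G : SimpleGraph (Fin n)) [DecidableRel G.Adj], 2 ≤ n →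
        G.Connected → (∀ v, G.degree v ≤ r) → graphLambda2 G ≤ 1 - ε →
        ForcesAverageDimension.{u} (graphDist G) c) ∧
    -- the bound for a general connected regular graph
    (∃ c κ : ℝ, 0 < c ∧ 0 < κ ∧
      ∀ (n r : ℕ) (G : SimpleGraph (Fin n)) [DecidableRel G.Adj], 3 ≤ n → 3 ≤ r →
        G.Connected → G.IsRegularOfDegree r →
        ∀ (X : Type u) [NormedAddCommGroup X] [NormedSpace ℝ X] [FiniteDimensional ℝ X]
          (α : ℝ) (f : Fin n → X), 0 < α →
          Real.sqrt (edgeAverageSq G f) ≤ α →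
          pairAverage (graphDist G) ≤
            Real.sqrt (pairAverage fun i j => ‖f i - f j‖ ^ 2) →
          κ * (n : ℝ) ^ (c * (1 - graphLambda2 G) / (α * Real.log r)) ≤
            (Module.finrank ℝ X : ℝ)) := by
  refine ⟨?_, ?_, ?_, ?_⟩
  · refine ⟨1 / 80000 / (168 * √(4 : ℕ) * Real.log (4 : ℕ)), ?_, fun N => ?_⟩
    · have : 0 < Real.log (4 : ℕ) := Real.log_pos (by norm_num)
      positivity
    · obtain ⟨n, hN, hn, G, _, hG, hreg, hgap⟩ := exists_four_regular_expander N
      refine ⟨n, hN, Fin n, inferInstance, hG.distMetricSpace, Fintype.card_fin n, ?_⟩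
      exact forcesAverageDimension_graphDist G (by norm_num) (by norm_num) hG (by simpa using hn)
        (fun v => (hreg v).le) hgap
  · refine ⟨4, 1 / 80000, by norm_num, by norm_num, fun N => ?_⟩
    obtain ⟨n, hN, -, G, inst, h⟩ := exists_four_regular_expander N
    exact ⟨n, hN, G, inst, h⟩
  · intro r ε hε
    -- Enlarging the degree bound to at least `3` makes its logarithm positive and covers every `r`.
    refine ⟨ε / (168 * √(max r 3 : ℕ) * Real.log (max r 3 : ℕ)), ?_, ?_⟩
    · have h3 : (3 : ℝ) ≤ (max r 3 : ℕ) := by exact_mod_cast le_max_right r 3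
      have : 0 < Real.log (max r 3 : ℕ) := Real.log_pos (by linarith)
      have : 0 < √((max r 3 : ℕ) : ℝ) := Real.sqrt_pos.2 (by linarith)
      positivity
    · intro n G _ hn hG hdeg hgap
      exact forcesAverageDimension_graphDist G (le_max_right r 3) hε hG (by simpa using hn)
        (fun v => (hdeg v).trans (le_max_left r 3)) hgap
  · refine ⟨1 / 84, 1 / 2, by norm_num, by norm_num, ?_⟩
    intro n r G _ hn hr hG hreg X _ _ _ α f hα hedge havg
    have := half_mul_rpow_le_finrank G hr hG (by rw [Fintype.card_fin]; omega) hreg f hα hedge havg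
    rwa [Fintype.card_fin] at this
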